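/- Let $(X,g)$ be a compact smooth Riemannian manifold without boundary, with Riemannian volume measure $V_g$ (neither orientability, nor connectedness, nor the normalization $V_g(X)=1$ is required), and let $1\le k\le\dim X$. For complex $k$-forms put $\langle\omega,\eta\rangle=\int_X g^k_x(\omega_x,\eta_x)\,dV_g(x)$, where $g^k$ is the Hermitian inner product on complex $k$-forms induced by $g$. Let $L^2\Omega^k_{\mathbb C}(X)$ be the space of square integrable complex $k$-forms, $d$ the exterior derivative on smooth complex forms, $d^*$ its adjoint with respect to these inner products, and $\Delta=d^*d+dd^*$. A smooth form $\omega$ is harmonic if $\Delta\omega=0$. Let $f:X\to X$ be a $C^1$ diffeomorphism and $\lambda\in\mathbb C$. Suppose that $\omega$ is a nonzero harmonic complex $k$-form and that $\alpha\in L^2\Omega^k_{\mathbb C}(X)$ lies in the $L^2$-closure of the set of all $d\beta$, $\beta$ a smooth complex $(k-1)$-form, such that $$f^*\omega=e^{\lambda}\omega+\alpha\quad\text{almost everywhere},\qquad (f^*\omega)_x(v_1,\dots,v_k)=\omega_{f(x)}(D_xf\,v_1,\dots,D_xf\,v_k).$$ Let $\|(D_xf^n)^{\wedge k}\|$ be the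 operator norm of $(D_xf^n)^{\wedge k}:\Lambda^kT_xX\to\Lambda^kT_{f^n(x)}X$ with respect to the inner products $\langle v_1\wedge\dots\wedge v_k,\,w_1\wedge\dots\wedge w_k\rangle=\det\big(g(v_i,w_j)\big)_{i,j}$. Then for every $n$ the supremum $\sup_{x\in X}\frac1n\log\|(D_xf^n)^{\wedge k}\|$ is finite, the limit $$\lambda^+(Df^{\wedge k})=\lim_{n\to\infty}\ \sup_{x\in X}\frac1n\log\big\|(D_xf^n)^{\wedge k}\big\|$$ exists in $\mathbb R$, and $\operatorname{Re}(\lambda)\le\lambda^+(Df^{\wedge k})$. -/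

import Mathlib

open MeasureTheory Filter Topology Bundle
open scoped Manifold ContDiff ENNReal

noncomputable section

namespace HodgeLyapunov

instance instFiniteDimensionalTangentSpace {m : ℕ} {X : Type*} [TopologicalSpace X]
    [ChartedSpace (EuclideanSpace ℝ (Fin m)) X] (x : X) :
    FiniteDimensional ℝ (TangentSpace (𝓡 m) x) :=
  inferInstanceAs (FiniteDimensional ℝ (EuclideanSpace ℝ (Fin m)))

section LinearAlgebra

variable {V W : Type*} [NormedAddCommGroup V] [InnerProductSpace ℝ V] [FiniteDimensional ℝ V]
  [NormedAddCommGroup W] [InnerProductSpace ℝ W] [FiniteDimensional ℝ W]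

/-- The Hermitian inner product on complex alternating `k`-forms on a Euclidean space `V`: the sum
of `a(e_I) * conj b(e_I)` over the increasing multi-indices `I` of length `k`, for an orthonormal
basis `e` of `V`; equivalently `1 / k!` times the sum over all multi-indices. -/
def formInner {k : ℕ} (a b : V [⋀^Fin k]→L[ℝ] ℂ) : ℂ :=
  (k.factorial : ℂ)⁻¹ * ∑ I : Fin k → Fin (Module.finrank ℝ V),
    a (fun i => stdOrthonormalBasis ℝ V (I i)) *
      (starRingEnd ℂ) (b (fun i => stdOrthonormalBasis ℝ V (I i)))

/-- The norm of `A^{∧k} : Λ^k V → Λ^k W`: the operator norm with respect to the inner products on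
the exterior powers such that `⟪v₁ ∧ ⋯ ∧ v_k, w₁ ∧ ⋯ ∧ w_k⟫ = det (⟪v_i, w_j⟫)`. -/
def wedgeOpNorm (k : ℕ) (A : V →L[ℝ] W) : ℝ :=
  ‖LinearMap.toContinuousLinearMap
    (exteriorPower.map k A.toLinearMap : ⋀[ℝ]^k V →ₗ[ℝ] ⋀[ℝ]^k W)‖

end LinearAlgebra

section Forms

/-- Complex `k`-forms on `X` (with no regularity): a field of alternating `ℝ`-multilinear maps
`(T_x X)^k → ℂ`. These are the same as the alternating `ℂ`-multilinear forms on the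
complexified tangent spaces. -/
abbrev Form (m : ℕ) (X : Type*) [TopologicalSpace X]
    [ChartedSpace (EuclideanSpace ℝ (Fin m)) X] (k : ℕ) : Type _ :=
  ∀ x : X, TangentSpace (𝓡 m) x [⋀^Fin k]→L[ℝ] ℂ

variable {m : ℕ} {X : Type*} [TopologicalSpace X] [ChartedSpace (EuclideanSpace ℝ (Fin m)) X]
  {k : ℕ}

/-- The form `w` read in the preferred chart at `x₀`, that is, the pullback of `w` under the
inverse of the chart. It is meaningful on the target of the chart. -/
def inChart (w : Form m X k) (x₀ : X) (y : EuclideanSpace ℝ (Fin m)) :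
    EuclideanSpace ℝ (Fin m) [⋀^Fin k]→L[ℝ] ℂ :=
  (w ((extChartAt (𝓡 m) x₀).symm y)).compContinuousLinearMap
    (mfderiv 𝓘(ℝ, EuclideanSpace ℝ (Fin m)) (𝓡 m) (extChartAt (𝓡 m) x₀).symm y)

/-- Smooth (`C^∞`) forms. -/
def IsSmooth (w : Form m X k) : Prop :=
  ∀ x₀ : X, ContDiffOn ℝ ∞ (inChart w x₀) (extChartAt (𝓡 m) x₀).target

/-- The exterior derivative of a form, computed at `x` in the preferred chart at `x`. -/
def d (w : Form m X k) : Form m X (k + 1) := fun x =>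
  (extDeriv (inChart w x) (extChartAt (𝓡 m) x x)).compContinuousLinearMap
    (mfderiv (𝓡 m) 𝓘(ℝ, EuclideanSpace ℝ (Fin m)) (extChartAt (𝓡 m) x) x)

/-- Pullback of a form under a (differentiable) map:
`(f^* w)_x (v₁, …, v_k) = w_{f x} (D_x f v₁, …, D_x f v_k)`. -/
def pullback (f : X → X) (w : Form m X k) : Form m X k := fun x =>
  (w (f x)).compContinuousLinearMap (mfderiv (𝓡 m) (𝓡 m) f x)

/-- Exact smooth forms: the image of `d` on smooth forms of one degree less (`0` in degree `0`). -/
def IsExact : {k : ℕ} → Form m X k → Prop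
  | 0, θ => θ = 0
  | _ + 1, θ => ∃ β, IsSmooth β ∧ θ = d β

end Forms

section Riemannian

variable {m : ℕ} {X : Type*} [TopologicalSpace X] [ChartedSpace (EuclideanSpace ℝ (Fin m)) X]
  [RiemannianBundle (fun x : X => TangentSpace (𝓡 m) x)] {k : ℕ}

/-- The density `√(det (g_ij))` of the metric in the preferred chart at `x₀`. -/
def chartDensity (x₀ : X) (y : EuclideanSpace ℝ (Fin m)) : ℝ :=
  √(Matrix.det (Matrix.of fun i j : Fin m =>
    inner ℝ
      (mfderiv 𝓘(ℝ, EuclideanSpace ℝ (Fin m)) (𝓡 m) (extChartAt (𝓡 m) x₀).symm y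
        (EuclideanSpace.single i (1 : ℝ)))
      (mfderiv 𝓘(ℝ, EuclideanSpace ℝ (Fin m)) (𝓡 m) (extChartAt (𝓡 m) x₀).symm y
        (EuclideanSpace.single j (1 : ℝ)))))

variable (m) in
/-- The Riemannian volume of the domain of the preferred chart at `x₀`, as a measure on `X`:
the image under the inverse of the chart of `√(det (g_ij)) dy`. -/
def chartVolume [MeasurableSpace X] (x₀ : X) : Measure X :=
  (((volume : Measure (EuclideanSpace ℝ (Fin m))).restrict
    (extChartAt (𝓡 m) x₀).target).withDensity
      fun y => ENNReal.ofReal (chartDensity x₀ y)).map (extChartAt (𝓡 m) x₀).symm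

variable (m X) in
/-- The Riemannian volume measure `V_g`. The measures `chartVolume m x₀` are the restrictions of
`V_g` to the domains of the charts; as these domains cover `X`, the supremum of these measures (in
the complete lattice of measures) is `V_g`. -/
def riemannianVolume [MeasurableSpace X] : Measure X :=
  ⨆ x₀ : X, chartVolume m x₀

variable (m) in
/-- The norm of `(D_x h)^{∧k} : Λ^k T_x X → Λ^k T_{h x} X` with respect to the metric `g`. -/
def wedgeNorm (k : ℕ) (h : X → X) (x : X) : ℝ :=
  wedgeOpNorm k (mfderiv (𝓡 m) (𝓡 m) h x)

variable [MeasurableSpace X]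

/-- The `L²` inner product `∫ ⟨w_x, η_x⟩ dV_g(x)` of forms. -/
def l2Inner (w η : Form m X k) : ℂ :=
  ∫ x, formInner (w x) (η x) ∂(riemannianVolume m X)

/-- The square of the `L²` norm, as an extended nonnegative number. -/
def l2NormSq (w : Form m X k) : ℝ≥0∞ :=
  ∫⁻ x, ENNReal.ofReal (formInner (w x) (w x)).re ∂(riemannianVolume m X)

/-- Square integrable forms: (almost everywhere) measurable in charts, with finite `L²` norm. -/
def IsL2 (α : Form m X k) : Prop :=
  (∀ x₀ : X, AEStronglyMeasurable (inChart α x₀)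
    (volume.restrict (extChartAt (𝓡 m) x₀).target)) ∧ l2NormSq α < ⊤

/-- `α` lies in the closure of `Im d` in the space of square integrable `k`-forms. -/
def MemClosureExact (α : Form m X k) : Prop :=
  IsL2 α ∧ ∀ ε : ℝ≥0∞, 0 < ε → ∃ θ : Form m X k, IsExact θ ∧ l2NormSq (α - θ) < ε

/-- `σ = d^* w`: the smooth `k`-form `σ` is the image of the `(k+1)`-form `w` under the adjoint of
`d` for the `L²` inner products on smooth forms. -/
def IsCodifferential (w : Form m X (k + 1)) (σ : Form m X k) : Prop :=
  IsSmooth σ ∧ ∀ β : Form m X k, IsSmooth β → l2Inner (d β) w = l2Inner β σ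

/-- `η = Δ w`, where `Δ = d^* d + d d^*` (and `Δ = d^* d` in degree `0`). -/
def IsLaplacian : {k : ℕ} → Form m X k → Form m X k → Prop
  | 0, w, η => IsCodifferential (d w) η
  | _ + 1, w, η => ∃ σ ρ, IsCodifferential w σ ∧
      IsCodifferential (d w) ρ ∧ η = ρ + d σ

/-- Harmonic forms: smooth forms `w` with `Δ w = 0`. -/
def IsHarmonic (w : Form m X k) : Prop :=
  IsSmooth w ∧ IsLaplacian w 0

end Riemannian

end HodgeLyapunov

end

/-!
Write `c n = ⟪(f^n)^* w, w⟫` for the `L²` inner products. The proof compares two computations of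
the growth of `c n`.

*Exact growth.* Since `Δ w = 0`, pairing `Δ w` with `w` gives `‖d w‖² + ‖d^* w‖² = 0`, so `w` is
orthogonal to every smooth exact form (`IsHarmonic.l2Inner_d`). The same holds for the pullback of
a smooth exact form under a `C¹` map (`l2Inner_pullback_d`), although this pullback is only
continuous. Indeed, every smooth form is a finite sum of pullbacks `H^* C` of smooth forms `C` on a
vector space under smooth maps `H` (`exists_eq_sum_pullE`); as `d` commutes with these pullbacks,
the claim is that `(H ∘ f)^* dC` is orthogonal to `w`. The `C¹` map `H ∘ f` into a vector space is
a pointwise limit of smooth maps, together with its first derivative and with uniform bounds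
(`hasSmoothApprox`), and for smooth maps `v` the form `v^* dC = d (v^* C)` is smooth and exact;
dominated convergence concludes. Finally, the pullback under a `C¹` diffeomorphism is bounded on
`L²`, because the volume measure is quasi-invariant with bounded density
(`exists_map_riemannianVolume_le`), so the orthogonality extends to the pullbacks of `L²` limits of
exact forms (`l2Inner_pullback_eq_zero_of_closure`). Pulling back `f^* w = e^λ w + α` by `f^n` and
pairing with `w` now gives `c (n + 1) = e^λ c n`, that is, `c n = e^{nλ} ‖w‖²`
(`l2Inner_pullback_iterate`), where `‖w‖² > 0`.

*Upper bound.* Pointwise, `|(f^n)^* w|` is at most a constant times `‖(D f^n)^{∧k}‖ |w ∘ f^n|`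
(`formNormSq_pullback_le`), so `|c n|` is at most a constant times `exp (s n)` with
`s n = sup_x log ‖(D_x f^n)^{∧k}‖` (`exists_norm_l2Inner_pullback_le`).

Hence `n Re λ ≤ s n + const` (`exists_mul_re_le`). As `s` is subadditive by the chain rule,
`s n / n` converges by Fekete's lemma; the inequality provides both the lower bound that makes the limit
finite and the comparison of the limit with `Re λ` (`exists_tendsto_of_subadditive`).

Norms of forms are only ever compared up to multiplicative constants, which do not affect the
exponential growth rates; this is why crude constants are used throughout.
-/

noncomputable section

namespace HodgeLyapunov

/-! ### Inner products of alternating forms and norms of exterior powers -/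

section LinearAlgebra
variable {V W : Type*} [NormedAddCommGroup V] [InnerProductSpace ℝ V] [FiniteDimensional ℝ V]
  [NormedAddCommGroup W] [InnerProductSpace ℝ W] [FiniteDimensional ℝ W]

lemma formInner_add_left {k : ℕ} (a a' b : V [⋀^Fin k]→L[ℝ] ℂ) :
    formInner (a + a') b = formInner a b + formInner a' b := by
  simp [formInner, add_mul, Finset.sum_add_distrib, mul_add]

lemma formInner_smul_left {k : ℕ} (c : ℂ) (a b : V [⋀^Fin k]→L[ℝ] ℂ) :
    formInner (c • a) b = c * formInner a b := by
  simp only [formInner, Finset.mul_sum]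
  refine Finset.sum_congr rfl fun I _ => ?_
  simp; ring

lemma formInner_conj {k : ℕ} (a b : V [⋀^Fin k]→L[ℝ] ℂ) :
    (starRingEnd ℂ) (formInner a b) = formInner b a := by
  simp only [formInner, map_mul, map_sum, map_inv₀, Complex.conj_natCast, Complex.conj_conj]
  congr 1
  exact Finset.sum_congr rfl fun I _ => mul_comm _ _

lemma formInner_self {k : ℕ} (a : V [⋀^Fin k]→L[ℝ] ℂ) :
    formInner a a = (((k.factorial : ℝ)⁻¹ * ∑ I : Fin k → Fin (Module.finrank ℝ V),
      ‖a (fun i => stdOrthonormalBasis ℝ V (I i))‖ ^ 2 : ℝ) : ℂ) := by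
  simp [formInner, Complex.mul_conj, Complex.normSq_eq_norm_sq]

/-- The squared norm of an alternating form for the Hermitian inner product `formInner`. -/
def formNormSq {k : ℕ} (a : V [⋀^Fin k]→L[ℝ] ℂ) : ℝ := (formInner a a).re

lemma formNormSq_eq {k : ℕ} (a : V [⋀^Fin k]→L[ℝ] ℂ) :
    formNormSq a = (k.factorial : ℝ)⁻¹ * ∑ I : Fin k → Fin (Module.finrank ℝ V),
      ‖a (fun i => stdOrthonormalBasis ℝ V (I i))‖ ^ 2 := by
  rw [formNormSq, formInner_self, Complex.ofReal_re]

lemma formNormSq_nonneg {k : ℕ} (a : V [⋀^Fin k]→L[ℝ] ℂ) : 0 ≤ formNormSq a := by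
  rw [formNormSq_eq]; positivity

lemma formInner_self_eq_formNormSq {k : ℕ} (a : V [⋀^Fin k]→L[ℝ] ℂ) :
    formInner a a = (formNormSq a : ℂ) := by
  rw [formNormSq_eq, formInner_self]

lemma norm_apply_sq_le {k : ℕ} (a : V [⋀^Fin k]→L[ℝ] ℂ)
    (I : Fin k → Fin (Module.finrank ℝ V)) :
    ‖a (fun i => stdOrthonormalBasis ℝ V (I i))‖ ^ 2 ≤ k.factorial * formNormSq a := by
  rw [formNormSq_eq, mul_inv_cancel_left₀ (by positivity)]
  exact Finset.single_le_sum (f := fun I : Fin k → Fin (Module.finrank ℝ V) =>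
    ‖a (fun i => stdOrthonormalBasis ℝ V (I i))‖ ^ 2) (fun _ _ => by positivity)
    (Finset.mem_univ I)

lemma formNormSq_le {k : ℕ} (a : V [⋀^Fin k]→L[ℝ] ℂ) {r : ℝ}
    (h : ∀ I : Fin k → Fin (Module.finrank ℝ V),
      ‖a (fun i => stdOrthonormalBasis ℝ V (I i))‖ ^ 2 ≤ r) :
    formNormSq a ≤ (Module.finrank ℝ V : ℝ) ^ k * r := by
  rw [formNormSq_eq]
  have h1 : ∑ I : Fin k → Fin (Module.finrank ℝ V),
      ‖a (fun i => stdOrthonormalBasis ℝ V (I i))‖ ^ 2 ≤ (Module.finrank ℝ V : ℝ) ^ k * r := by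
    refine (Finset.sum_le_sum fun I _ => h I).trans ?_
    simp
  refine le_trans ?_ h1
  refine mul_le_of_le_one_left (by positivity) (inv_le_one_of_one_le₀ ?_)
  exact_mod_cast k.factorial_pos

lemma formNormSq_eq_zero {k : ℕ} {a : V [⋀^Fin k]→L[ℝ] ℂ} (h : formNormSq a = 0) : a = 0 := by
  have h0 : ∀ I : Fin k → Fin (Module.finrank ℝ V),
      a (fun i => stdOrthonormalBasis ℝ V (I i)) = 0 := fun I => by
    have := norm_apply_sq_le a I
    rw [h, mul_zero] at this
    simpa using le_antisymm this (by positivity)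
  have : a.toMultilinearMap = 0 := by
    refine Module.Basis.ext_multilinear (fun _ => (stdOrthonormalBasis ℝ V).toBasis) fun I => ?_
    simpa using h0 I
  ext v
  exact congrArg (fun g : MultilinearMap ℝ (fun _ : Fin k => V) ℂ => g v) this

/-- A weighted form of the Cauchy-Schwarz inequality. -/
lemma norm_formInner_le {k : ℕ} (a b : V [⋀^Fin k]→L[ℝ] ℂ) {t : ℝ} (ht : 0 < t) :
    ‖formInner a b‖ ≤ t * formNormSq a + t⁻¹ * formNormSq b := by
  rw [formInner, norm_mul, formNormSq_eq, formNormSq_eq]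
  have h1 : ‖((k.factorial : ℂ))⁻¹‖ = (k.factorial : ℝ)⁻¹ := by simp
  have key : ∀ x y : ℝ, 0 ≤ x → 0 ≤ y → x * y ≤ t * x ^ 2 + t⁻¹ * y ^ 2 := fun x y hx hy => by
    have h2 := sq_nonneg (t * x - y)
    have h3 : t * (x * y) ≤ t * (t * x ^ 2 + t⁻¹ * y ^ 2) := by
      rw [mul_add, mul_inv_cancel_left₀ ht.ne']
      nlinarith [mul_nonneg (mul_nonneg ht.le hx) hy]
    exact le_of_mul_le_mul_left h3 ht
  rw [h1, mul_left_comm, mul_left_comm t⁻¹, ← mul_add, Finset.mul_sum, Finset.mul_sum,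
    ← Finset.sum_add_distrib]
  refine mul_le_mul_of_nonneg_left ?_ (by positivity)
  refine (norm_sum_le _ _).trans (Finset.sum_le_sum fun I _ => ?_)
  rw [norm_mul, RCLike.norm_conj]
  exact key _ _ (norm_nonneg _) (norm_nonneg _)

open Matrix in
/-- The inner product of forms in an arbitrary basis `v`: the sum over multi-indices is weighted by
products of entries of the inverse of the Gram matrix of `v`. In coordinates on a manifold, the
right hand side depends continuously on the metric, whereas an orthonormal basis does not come with
any continuity in the base point. -/
lemma formInner_eq_gram {k : ℕ} {ι : Type*} [Fintype ι] [DecidableEq ι] (v : Module.Basis ι ℝ V)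
    (a b : V [⋀^Fin k]→L[ℝ] ℂ) :
    formInner a b = (k.factorial : ℂ)⁻¹ * ∑ I : Fin k → ι, ∑ J : Fin k → ι,
      ((∏ l, (Matrix.of fun i j => inner ℝ (v i) (v j))⁻¹ (I l) (J l) : ℝ) : ℂ) *
        (a (fun i => v (I i)) * (starRingEnd ℂ) (b (fun i => v (J i)))) := by
  set e := stdOrthonormalBasis ℝ V
  set P : Matrix (Fin (Module.finrank ℝ V)) ι ℝ := Matrix.of fun p i => v.repr (e p) i
  set M : Matrix ι (Fin (Module.finrank ℝ V)) ℝ := Matrix.of fun i p => inner ℝ (e p) (v i)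
  have hP : ∀ p, e p = ∑ i, P p i • v i := fun p => (v.sum_repr (e p)).symm
  have hM : ∀ i, v i = ∑ p, M i p • e p := fun i => (e.sum_repr' (v i)).symm
  -- `M` and `P` are the two change of basis matrices, and the Gram matrix is `M * Mᵀ`.
  have hMP : M * P = 1 := by
    ext i j
    have h1 : v i = ∑ j, (M * P) i j • v j := by
      simp only [Matrix.mul_apply, Finset.sum_smul]
      rw [Finset.sum_comm]
      conv_lhs => rw [hM i]
      refine Finset.sum_congr rfl fun p _ => ?_
      rw [hP p, Finset.smul_sum]
      simp only [mul_smul]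
    have h2 := congrArg (fun x => v.repr x j) h1
    simpa [Finsupp.single_apply, Matrix.one_apply] using h2.symm
  have hPM : P * M = 1 := by
    ext p q
    have h1 : inner ℝ (e q) (e p) = (P * M) p q := by
      rw [hP p, inner_sum]
      simp [Matrix.mul_apply, inner_smul_right, M]
    rw [← h1, e.inner_eq_ite]
    simp [Matrix.one_apply, eq_comm]
  have hG : (Matrix.of fun i j => inner ℝ (v i) (v j)) = M * Mᵀ := by
    ext i j
    simp only [Matrix.of_apply, Matrix.mul_apply, Matrix.transpose_apply, M]
    rw [← e.sum_inner_mul_inner]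
    simp only [real_inner_comm]
  have hGi : (Matrix.of fun i j => inner ℝ (v i) (v j))⁻¹ = Pᵀ * P := by
    refine Matrix.inv_eq_right_inv ?_
    rw [hG, Matrix.mul_assoc, ← Matrix.mul_assoc Mᵀ, ← Matrix.transpose_mul, hPM,
      Matrix.transpose_one, Matrix.one_mul, hMP]
  have hexp : ∀ (c : V [⋀^Fin k]→L[ℝ] ℂ) (A : Fin k → Fin (Module.finrank ℝ V)),
      c (fun i => e (A i)) =
        ∑ I : Fin k → ι, ((∏ l, P (A l) (I l) : ℝ) : ℂ) * c (fun i => v (I i)) := fun c A => by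
    have h1 : (fun i => e (A i)) = fun i => ∑ j, P (A i) j • v j := funext fun i => hP _
    rw [h1]
    have h2 := c.toMultilinearMap.map_sum (fun i j => P (A i) j • v j)
    refine h2.trans (Finset.sum_congr rfl fun I _ => ?_)
    rw [c.toMultilinearMap.map_smul_univ (fun i => P (A i) (I i)) (fun i => v (I i))]
    rw [Complex.real_smul]; rfl
  have hdef : formInner a b = (k.factorial : ℂ)⁻¹ * ∑ A : Fin k → Fin (Module.finrank ℝ V),
      a (fun i => e (A i)) * (starRingEnd ℂ) (b (fun i => e (A i))) := rfl
  rw [hdef, hGi]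
  congr 1
  simp only [hexp, map_sum, map_mul, Complex.conj_ofReal, Finset.sum_mul_sum]
  rw [Finset.sum_comm]
  refine Finset.sum_congr rfl fun I _ => ?_
  rw [Finset.sum_comm]
  refine Finset.sum_congr rfl fun J _ => ?_
  have h3 : (∏ l, (Pᵀ * P) (I l) (J l)) =
      ∑ A : Fin k → Fin (Module.finrank ℝ V), (∏ l, P (A l) (I l)) * ∏ l, P (A l) (J l) := by
    simp only [Matrix.mul_apply, Matrix.transpose_apply, ← Finset.prod_mul_distrib]
    rw [Finset.prod_univ_sum, Fintype.piFinset_univ]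
  rw [h3, Complex.ofReal_sum, Finset.sum_mul]
  refine Finset.sum_congr rfl fun A _ => ?_
  push_cast; ring

lemma norm_ιMulti_sq_le {k : ℕ} (v : Fin k → V) {r : ℝ} (hr : 0 ≤ r) (hv : ∀ i, ‖v i‖ ≤ r) :
    ‖exteriorPower.ιMulti ℝ k v‖ ^ 2 ≤ k.factorial * r ^ (2 * k) := by
  rw [← real_inner_self_eq_norm_sq, exteriorPower.inner_ιMulti_self]
  refine (le_abs_self _).trans ?_
  have := Matrix.det_le (A := Matrix.gram ℝ v) (abv := AbsoluteValue.abs) (x := r ^ 2)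
    (fun i j => by
      rw [Matrix.gram_apply, sq]
      exact (abs_real_inner_le_norm _ _).trans (mul_le_mul (hv i) (hv j) (norm_nonneg _) hr))
  simpa [pow_mul] using this

omit [FiniteDimensional ℝ V] in
lemma norm_repr_le {ι : Type*} [Fintype ι] (o : OrthonormalBasis ι ℝ V) (x : V) (i : ι) :
    ‖o.repr x i‖ ≤ ‖x‖ := by
  rw [o.repr_apply_apply]
  simpa using norm_inner_le_norm (𝕜 := ℝ) (o i) x

lemma exteriorPower_basis_apply (k : ℕ) (s : Set.powersetCard (Fin (Module.finrank ℝ V)) k) :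
    ∃ I : Fin k → Fin (Module.finrank ℝ V),
      (stdOrthonormalBasis ℝ V).exteriorPower k s =
        exteriorPower.ιMulti ℝ k fun i => stdOrthonormalBasis ℝ V (I i) := by
  refine ⟨Set.powersetCard.ofFinEmbEquiv.symm s, ?_⟩
  rw [← OrthonormalBasis.coe_toBasis, OrthonormalBasis.toBasis_exteriorPower,
    exteriorPower.basis_apply]
  simp [exteriorPower.ιMulti_family, Function.comp_def]

/-- The operator norm of a linear map on an exterior power is controlled by the values on the
wedge products of basis vectors. -/
lemma norm_exteriorPower_apply_le {k : ℕ} {F : Type*} [NormedAddCommGroup F] [NormedSpace ℝ F]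
    (T : ⋀[ℝ]^k V →ₗ[ℝ] F) {r : ℝ}
    (h : ∀ I : Fin k → Fin (Module.finrank ℝ V),
      ‖T (exteriorPower.ιMulti ℝ k fun i => stdOrthonormalBasis ℝ V (I i))‖ ≤ r) (ξ : ⋀[ℝ]^k V) :
    ‖T ξ‖ ≤ (Module.finrank ℝ V).choose k * r * ‖ξ‖ := by
  set o := (stdOrthonormalBasis ℝ V).exteriorPower k
  have hξ := o.sum_repr ξ
  have hcard : Fintype.card (Set.powersetCard (Fin (Module.finrank ℝ V)) k) =
      (Module.finrank ℝ V).choose k := by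
    rw [← Nat.card_eq_fintype_card, Set.powersetCard.card, Nat.card_eq_fintype_card,
      Fintype.card_fin]
  calc ‖T ξ‖ = ‖∑ s, o.repr ξ s • T (o s)‖ := by
        conv_lhs => rw [← hξ]
        simp
    _ ≤ ∑ s : Set.powersetCard (Fin (Module.finrank ℝ V)) k, ‖ξ‖ * r := by
        refine (norm_sum_le _ _).trans (Finset.sum_le_sum fun s _ => ?_)
        rw [norm_smul]
        obtain ⟨I, hI⟩ := exteriorPower_basis_apply (V := V) k s
        refine mul_le_mul (norm_repr_le o ξ s) ?_ (norm_nonneg _) (norm_nonneg _)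
        rw [show o s = _ from hI]
        exact h I
    _ = _ := by
        rw [Finset.sum_const, Finset.card_univ, hcard, nsmul_eq_mul]; ring

lemma wedgeOpNorm_le (k : ℕ) (A : V →L[ℝ] W) {r : ℝ} (hr : 0 ≤ r) (hA : ‖A‖ ≤ r) :
    wedgeOpNorm k A ≤ (Module.finrank ℝ V).choose k * √(k.factorial * r ^ (2 * k)) := by
  refine ContinuousLinearMap.opNorm_le_bound _ (by positivity) fun ξ => ?_
  refine norm_exteriorPower_apply_le (exteriorPower.map k A.toLinearMap) (fun I => ?_) ξ
  rw [exteriorPower.map_apply_ιMulti]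
  refine Real.le_sqrt_of_sq_le (norm_ιMulti_sq_le _ hr fun i => ?_)
  refine (A.le_opNorm _).trans ?_
  simpa using hA

lemma wedgeOpNorm_comp_le {U : Type*} [NormedAddCommGroup U] [InnerProductSpace ℝ U]
    [FiniteDimensional ℝ U] (k : ℕ) (B : W →L[ℝ] U) (A : V →L[ℝ] W) :
    wedgeOpNorm k (B.comp A) ≤ wedgeOpNorm k B * wedgeOpNorm k A := by
  have : LinearMap.toContinuousLinearMap
      (exteriorPower.map k (B.comp A).toLinearMap : ⋀[ℝ]^k V →ₗ[ℝ] ⋀[ℝ]^k U) =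
      (LinearMap.toContinuousLinearMap (exteriorPower.map k B.toLinearMap)).comp
        (LinearMap.toContinuousLinearMap (exteriorPower.map k A.toLinearMap)) := by
    ext1 ξ
    simp only [LinearMap.coe_toContinuousLinearMap', ContinuousLinearMap.comp_apply]
    rw [show (B.comp A).toLinearMap = B.toLinearMap ∘ₗ A.toLinearMap from rfl,
      exteriorPower.map_comp]
    rfl
  rw [wedgeOpNorm, this]
  exact ContinuousLinearMap.opNorm_comp_le _ _

lemma wedgeOpNorm_nonneg (k : ℕ) (A : V →L[ℝ] W) : 0 ≤ wedgeOpNorm k A := by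
  exact ContinuousLinearMap.opNorm_nonneg _

lemma wedgeOpNorm_pos {k : ℕ} (hk : k ≤ Module.finrank ℝ V) {A : V →L[ℝ] W}
    (hA : Function.Injective A) : 0 < wedgeOpNorm k A := by
  refine lt_of_le_of_ne (wedgeOpNorm_nonneg k A) fun h => ?_
  have hinj := exteriorPower.map_injective_field (n := k) (f := A.toLinearMap)
    hA
  have hpos : 0 < Module.finrank ℝ (⋀[ℝ]^k V) := by
    rw [exteriorPower.finrank_eq]; exact Nat.choose_pos hk
  obtain ⟨ξ, hξ⟩ := (Module.finrank_pos_iff_exists_ne_zero (R := ℝ)).mp hpos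
  refine hξ (hinj ?_)
  rw [map_zero]
  exact congrArg (fun T : ⋀[ℝ]^k V →L[ℝ] ⋀[ℝ]^k W => T ξ)
    ((ContinuousLinearMap.opNorm_zero_iff _).mp h.symm)

/-- A constant `C` such that `|A^* a|² ≤ C ‖A^{∧k}‖² |a|²` for `k`-forms `a` on a `d`-dimensional
Euclidean space. It is not optimal. -/
def pullbackConst (d k : ℕ) : ℝ :=
  (d : ℝ) ^ k * ((d.choose k : ℝ) ^ 2 * (k.factorial : ℝ) ^ 2)

/-- The norm of the pullback of a form is controlled by the norm of the exterior power: on a wedge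
product of basis vectors, `A^* a` is the linear form induced by `a` on `Λ^k W`, evaluated at the
image of this product under `A^{∧k}`. -/
lemma formNormSq_comp_le {k : ℕ} (hVW : Module.finrank ℝ V = Module.finrank ℝ W)
    (a : W [⋀^Fin k]→L[ℝ] ℂ) (A : V →L[ℝ] W) :
    formNormSq (a.compContinuousLinearMap A) ≤
      pullbackConst (Module.finrank ℝ V) k * wedgeOpNorm k A ^ 2 * formNormSq a := by
  have h1 : ∀ ξ : ⋀[ℝ]^k W, ‖exteriorPower.alternatingMapLinearEquiv a.toAlternatingMap ξ‖ ≤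
      (Module.finrank ℝ W).choose k * √(k.factorial * formNormSq a) * ‖ξ‖ := fun ξ => by
    refine norm_exteriorPower_apply_le _ (fun I => ?_) ξ
    rw [exteriorPower.alternatingMapLinearEquiv_apply_ιMulti]
    exact Real.le_sqrt_of_sq_le (norm_apply_sq_le a I)
  have h0 := formNormSq_nonneg a
  have h2 : ∀ I : Fin k → Fin (Module.finrank ℝ V),
      ‖(a.compContinuousLinearMap A) (fun i => stdOrthonormalBasis ℝ V (I i))‖ ^ 2 ≤
      ((Module.finrank ℝ V).choose k : ℝ) ^ 2 * (k.factorial : ℝ) ^ 2 * wedgeOpNorm k A ^ 2 *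
        formNormSq a := fun I => by
    set ζ := exteriorPower.ιMulti ℝ k fun i => stdOrthonormalBasis ℝ V (I i)
    have h3 : (a.compContinuousLinearMap A) (fun i => stdOrthonormalBasis ℝ V (I i)) =
        exteriorPower.alternatingMapLinearEquiv a.toAlternatingMap
          (exteriorPower.map k A.toLinearMap ζ) := by
      rw [exteriorPower.map_apply_ιMulti, exteriorPower.alternatingMapLinearEquiv_apply_ιMulti]
      rfl
    have h4 : ‖exteriorPower.map k A.toLinearMap ζ‖ ≤ wedgeOpNorm k A * ‖ζ‖ :=
      (LinearMap.toContinuousLinearMap (exteriorPower.map k A.toLinearMap)).le_opNorm ζ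
    have h5 : ‖ζ‖ ^ 2 ≤ k.factorial := by
      simpa using norm_ιMulti_sq_le (r := 1) (fun i => stdOrthonormalBasis ℝ V (I i)) zero_le_one
        (fun i => by simp)
    rw [h3]
    calc _ ≤ ((Module.finrank ℝ W).choose k * √(k.factorial * formNormSq a) *
          (wedgeOpNorm k A * ‖ζ‖)) ^ 2 :=
          pow_le_pow_left₀ (norm_nonneg _) ((h1 _).trans (by gcongr)) 2
      _ = ((Module.finrank ℝ V).choose k : ℝ) ^ 2 * (k.factorial * formNormSq a) *
          wedgeOpNorm k A ^ 2 * ‖ζ‖ ^ 2 := by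
          rw [mul_pow, mul_pow, Real.sq_sqrt (by positivity), hVW]; ring
      _ ≤ ((Module.finrank ℝ V).choose k : ℝ) ^ 2 * (k.factorial * formNormSq a) *
          wedgeOpNorm k A ^ 2 * k.factorial := by gcongr
      _ = _ := by ring
  refine (formNormSq_le _ h2).trans (le_of_eq ?_)
  rw [pullbackConst]; ring

lemma formNormSq_comp_le_of_norm_le {k : ℕ} {F : Type*} [NormedAddCommGroup F] [NormedSpace ℝ F]
    (a : F [⋀^Fin k]→L[ℝ] ℂ) (A : V →L[ℝ] F) {r : ℝ} (hA : ‖A‖ ≤ r) :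
    formNormSq (a.compContinuousLinearMap A) ≤
      (Module.finrank ℝ V : ℝ) ^ k * (‖a‖ * r ^ k) ^ 2 := by
  refine formNormSq_le _ fun I => pow_le_pow_left₀ (norm_nonneg _) ?_ 2
  rw [ContinuousAlternatingMap.compContinuousLinearMap_apply]
  refine (a.le_opNorm _).trans (mul_le_mul_of_nonneg_left ?_ (norm_nonneg _))
  refine (Finset.prod_le_prod (fun i _ => norm_nonneg _) (g := fun _ => r) fun i _ => ?_).trans
    (by simp)
  refine (A.le_opNorm _).trans ?_
  simpa using hA

omit [FiniteDimensional ℝ W] in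
open Matrix in
/-- A linear map expands the volume of a parallelotope at most by a factor that depends on its norm;
`Matrix.det_le` replaces the Hadamard inequality here, at the cost of a factorial. -/
lemma det_gram_map_le {ι : Type*} [Fintype ι] [DecidableEq ι]
    (hι : Fintype.card ι = Module.finrank ℝ V) (v : ι → V) (B : V →L[ℝ] W) {r : ℝ} (hr : 0 ≤ r)
    (hB : ‖B‖ ≤ r) :
    (Matrix.of fun i j => inner ℝ (B (v i)) (B (v j))).det ≤
      ((Fintype.card ι).factorial * r ^ (2 * Fintype.card ι)) *
        (Matrix.of fun i j => inner ℝ (v i) (v j)).det := by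
  set e : OrthonormalBasis ι ℝ V := (stdOrthonormalBasis ℝ V).reindex
    (Fintype.equivOfCardEq (by rw [hι, Fintype.card_fin]))
  set M : Matrix ι ι ℝ := Matrix.of fun i p => inner ℝ (e p) (v i)
  have hM : ∀ i, v i = ∑ p, M i p • e p := fun i => (e.sum_repr' (v i)).symm
  have h1 : (Matrix.of fun i j => inner ℝ (v i) (v j)) = M * Mᵀ := by
    ext i j
    simp only [Matrix.of_apply, Matrix.mul_apply, Matrix.transpose_apply, M]
    rw [← e.sum_inner_mul_inner]
    simp only [real_inner_comm]
  set H : Matrix ι ι ℝ := Matrix.of fun p q => inner ℝ (B (e p)) (B (e q))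
  have h2 : (Matrix.of fun i j => inner ℝ (B (v i)) (B (v j))) = M * H * Mᵀ := by
    ext i j
    rw [Matrix.of_apply, hM i, hM j]
    simp only [map_sum, map_smul, sum_inner, inner_sum, inner_smul_left, inner_smul_right,
      Matrix.mul_apply, Matrix.transpose_apply, Finset.sum_mul, H, Matrix.of_apply]
    refine Finset.sum_congr rfl fun p _ => ?_
    rw [Finset.mul_sum]
    refine Finset.sum_congr rfl fun q _ => ?_
    rw [real_inner_comm, conj_trivial]; ring
  have h3 : H.det ≤ (Fintype.card ι).factorial * r ^ (2 * Fintype.card ι) := by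
    refine (le_abs_self _).trans ?_
    have hBe : ∀ i, ‖B (e i)‖ ≤ r := fun i => (B.le_opNorm _).trans (by simpa using hB)
    have := Matrix.det_le (A := H) (abv := AbsoluteValue.abs) (x := r ^ 2)
      (fun i j => by
        rw [sq]
        exact (abs_real_inner_le_norm _ _).trans
          (mul_le_mul (hBe i) (hBe j) (norm_nonneg _) hr))
    simpa [pow_mul] using this
  rw [h2, h1, Matrix.det_mul, Matrix.det_mul, Matrix.det_mul, Matrix.det_transpose]
  nlinarith [mul_le_mul_of_nonneg_left h3 (mul_self_nonneg M.det)]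

end LinearAlgebra

/-! ### Pullbacks of forms from vector spaces -/

/-- The model space of the manifold. -/
abbrev Model (m : ℕ) : Type := EuclideanSpace ℝ (Fin m)

section Composition
variable {E F : Type*} [NormedAddCommGroup E] [NormedSpace ℝ E] [NormedAddCommGroup F]
  [NormedSpace ℝ F] {k : ℕ}

/-- Antisymmetrization as a bounded operator: a left inverse, up to the factor `k!`, of the
inclusion of alternating maps into multilinear maps. -/
def alternatizationCLM :
    ContinuousMultilinearMap ℝ (fun _ : Fin k => E) ℂ →L[ℝ] E [⋀^Fin k]→L[ℝ] ℂ :=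
  LinearMap.mkContinuous
    { toFun := ContinuousMultilinearMap.alternatization
      map_add' := map_add _
      map_smul' := fun c f => by
        ext v
        simp [ContinuousMultilinearMap.alternatization_apply_apply, Finset.mul_sum,
          mul_smul_comm] }
    k.factorial fun f => by
      refine ContinuousAlternatingMap.opNorm_le_bound _
        (mul_nonneg (Nat.cast_nonneg _) (norm_nonneg _)) fun v => ?_
      simp only [LinearMap.coe_mk, AddHom.coe_mk,
        ContinuousMultilinearMap.alternatization_apply_apply]
      refine (norm_sum_le _ _).trans ?_
      have h : ∀ σ : Equiv.Perm (Fin k), ‖Equiv.Perm.sign σ • f (v ∘ σ)‖ ≤ ‖f‖ * ∏ i, ‖v i‖ :=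
        fun σ => by
          have h1 : ‖Equiv.Perm.sign σ • f (v ∘ σ)‖ = ‖f (v ∘ σ)‖ := by
            rcases Int.units_eq_one_or (Equiv.Perm.sign σ) with h | h <;> simp [h]
          rw [h1]
          refine (f.le_opNorm _).trans_eq ?_
          congr 1
          exact Equiv.prod_comp σ fun i => ‖v i‖
      refine (Finset.sum_le_sum fun σ _ => h σ).trans_eq ?_
      simp [Fintype.card_perm, mul_assoc]

lemma alternatizationCLM_coe (a : E [⋀^Fin k]→L[ℝ] ℂ) :
    alternatizationCLM a.toContinuousMultilinearMap = (k.factorial : ℝ) • a := by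
  ext v
  have h : ∀ σ : Equiv.Perm (Fin k), Equiv.Perm.sign σ • a (v ∘ σ) = a v := fun σ => by
    have h1 : a (v ∘ σ) = Equiv.Perm.sign σ • a v := a.toAlternatingMap.map_perm v σ
    rw [h1, smul_smul, Int.units_mul_self, one_smul]
  have h2 : alternatizationCLM a.toContinuousMultilinearMap v =
      ∑ σ : Equiv.Perm (Fin k), Equiv.Perm.sign σ • a (v ∘ σ) :=
    ContinuousMultilinearMap.alternatization_apply_apply _ _
  rw [h2]
  simp [h, Fintype.card_perm]

/-- The pullback of alternating forms is smooth in the form and in the linear map. The statement for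
multilinear maps carries over by antisymmetrization. -/
lemma contDiff_compContinuousLinearMap {n : WithTop ℕ∞} :
    ContDiff ℝ n fun p : (F [⋀^Fin k]→L[ℝ] ℂ) × (E →L[ℝ] F) =>
      p.1.compContinuousLinearMap p.2 := by
  have h : (fun p : (F [⋀^Fin k]→L[ℝ] ℂ) × (E →L[ℝ] F) => p.1.compContinuousLinearMap p.2) =
      fun p => (k.factorial : ℝ)⁻¹ • alternatizationCLM
        (ContinuousMultilinearMap.compContinuousLinearMapContinuousMultilinear ℝ
          (fun _ : Fin k => E) (fun _ => F) ℂ (fun _ => p.2)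
          (ContinuousAlternatingMap.toContinuousMultilinearMapCLM ℝ p.1)) := by
    funext p
    have : (ContinuousMultilinearMap.compContinuousLinearMapContinuousMultilinear ℝ
          (fun _ : Fin k => E) (fun _ => F) ℂ (fun _ => p.2)
          (ContinuousAlternatingMap.toContinuousMultilinearMapCLM ℝ p.1)) =
        (p.1.compContinuousLinearMap p.2).toContinuousMultilinearMap := rfl
    rw [this, alternatizationCLM_coe, smul_smul, inv_mul_cancel₀ (by positivity), one_smul]
  rw [h]
  have h1 : ContDiff ℝ n fun p : (F [⋀^Fin k]→L[ℝ] ℂ) × (E →L[ℝ] F) =>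
      ContinuousMultilinearMap.compContinuousLinearMapContinuousMultilinear ℝ
        (fun _ : Fin k => E) (fun _ => F) ℂ (fun _ => p.2) :=
    (ContinuousMultilinearMap.contDiff _).comp (contDiff_pi.mpr fun _ => contDiff_snd)
  have h2 : ContDiff ℝ n fun p : (F [⋀^Fin k]→L[ℝ] ℂ) × (E →L[ℝ] F) =>
      ContinuousAlternatingMap.toContinuousMultilinearMapCLM ℝ p.1 :=
    (ContinuousLinearMap.contDiff _).comp contDiff_fst
  exact ((alternatizationCLM (E := E) (k := k)).contDiff.comp (h1.clm_apply h2)).const_smul _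
end Composition

section Charts
variable {m : ℕ} {X : Type*} [TopologicalSpace X] [ChartedSpace (EuclideanSpace ℝ (Fin m)) X]
  {F : Type*} [NormedAddCommGroup F] [NormedSpace ℝ F] {k : ℕ}

/-- The derivative of a vector-valued function on `X`: `mfderiv`, with the codomain written as the
vector space `F` instead of its tangent space at `H x`, so that derivatives at different points can
be compared and normed. -/
def dv (H : X → F) (x : X) : TangentSpace (𝓡 m) x →L[ℝ] F := mfderiv (𝓡 m) 𝓘(ℝ, F) H x

/-- The pullback to `X` of a form `C` on a vector space `F` under a map `H : X → F`. -/
def pullE (H : X → F) (C : F → F [⋀^Fin k]→L[ℝ] ℂ) : Form m X k := fun x =>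
  (C (H x)).compContinuousLinearMap (dv (m := m) H x)

/-- Continuous forms, that is, forms which are continuous in the preferred charts. -/
def IsContForm (a : Form m X k) : Prop :=
  ∀ x₀ : X, ContinuousOn (inChart a x₀) (extChartAt (𝓡 m) x₀).target

lemma IsSmooth.isContForm {a : Form m X k} (h : IsSmooth a) : IsContForm a := fun x₀ =>
  (h x₀).continuousOn

lemma IsContForm.add {a b : Form m X k} (ha : IsContForm a) (hb : IsContForm b) :
    IsContForm (a + b) := fun x₀ => (ha x₀).add (hb x₀)

lemma IsContForm.smul {a : Form m X k} (c : ℂ) (ha : IsContForm a) : IsContForm (c • a) :=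
  fun x₀ => (ha x₀).const_smul c

lemma IsContForm.sum {ι : Type*} (s : Finset ι) {a : ι → Form m X k}
    (ha : ∀ i ∈ s, IsContForm (a i)) :
    IsContForm (∑ i ∈ s, a i) := by
  classical
  induction s using Finset.induction_on with
  | empty => exact fun x₀ => continuousOn_const (c := 0)
  | insert i s hi ih =>
    rw [Finset.sum_insert hi]
    exact (ha i (by simp)).add (ih fun j hj => ha j (by simp [hj]))

lemma dv_comp {f : X → X} (hf : ContMDiff (𝓡 m) (𝓡 m) 1 f) {H : X → F}
    (hH : ContMDiff (𝓡 m) 𝓘(ℝ, F) 1 H) (x : X) :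
    dv (m := m) (H ∘ f) x = (dv (m := m) H (f x)).comp (mfderiv (𝓡 m) (𝓡 m) f x) :=
  mfderiv_comp x (hH.mdifferentiable one_ne_zero _) (hf.mdifferentiable one_ne_zero _)

lemma pullback_pullE {f : X → X} (hf : ContMDiff (𝓡 m) (𝓡 m) 1 f) {H : X → F}
    (hH : ContMDiff (𝓡 m) 𝓘(ℝ, F) 1 H) (C : F → F [⋀^Fin k]→L[ℝ] ℂ) :
    pullback f (pullE (m := m) H C) = pullE (m := m) (H ∘ f) C := by
  funext x
  rw [pullE, dv_comp hf hH]
  rfl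

lemma pullback_comp {f g : X → X} (hf : ContMDiff (𝓡 m) (𝓡 m) 1 f)
    (hg : ContMDiff (𝓡 m) (𝓡 m) 1 g) (a : Form m X k) :
    pullback (f ∘ g) a = pullback g (pullback f a) := by
  funext x
  rw [pullback, mfderiv_comp x (hf.mdifferentiable one_ne_zero _)
    (hg.mdifferentiable one_ne_zero _)]
  rfl

lemma pullback_add (f : X → X) (a b : Form m X k) :
    pullback f (a + b) = pullback f a + pullback f b := rfl

lemma pullback_smul (f : X → X) (c : ℂ) (a : Form m X k) :
    pullback f (c • a) = c • pullback f a := rfl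

lemma pullback_sum {ι : Type*} (s : Finset ι) (f : X → X) (a : ι → Form m X k) :
    pullback f (∑ i ∈ s, a i) = ∑ i ∈ s, pullback f (a i) := by
  classical
  induction s using Finset.induction_on with
  | empty => rfl
  | insert i s hi ih => rw [Finset.sum_insert hi, Finset.sum_insert hi, ← ih]; rfl

lemma pullback_id (a : Form m X k) : pullback id a = a := by
  funext x
  rw [pullback, mfderiv_id]
  rfl

lemma IsSmooth.add {a b : Form m X k} (ha : IsSmooth a) (hb : IsSmooth b) : IsSmooth (a + b) :=
  fun x₀ => (ha x₀).add (hb x₀)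

lemma IsSmooth.sum {ι : Type*} (s : Finset ι) {a : ι → Form m X k}
    (ha : ∀ i ∈ s, IsSmooth (a i)) :
    IsSmooth (∑ i ∈ s, a i) := by
  classical
  induction s using Finset.induction_on with
  | empty => exact fun x₀ => contDiffOn_const (c := 0)
  | insert i s hi ih =>
    rw [Finset.sum_insert hi]
    exact (ha i (by simp)).add (ih fun j hj => ha j (by simp [hj]))

lemma d_add {a b : Form m X k} (ha : IsSmooth a) (hb : IsSmooth b) : d (a + b) = d a + d b := by
  funext x
  have hx : extChartAt (𝓡 m) x x ∈ (extChartAt (𝓡 m) x).target := mem_extChartAt_target x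
  have h : ∀ {c : Form m X k}, IsSmooth c →
      DifferentiableAt ℝ (inChart c x) (extChartAt (𝓡 m) x x) := fun hc =>
    ((hc x).contDiffAt
      ((isOpen_extChartAt_target (I := 𝓡 m) x).mem_nhds hx)).differentiableAt (by simp)
  have h1 : inChart (a + b) x = inChart a x + inChart b x := rfl
  rw [d, h1, extDeriv_add (h ha) (h hb)]
  rfl

lemma d_zero : d (0 : Form m X k) = 0 := by
  have h0 : IsSmooth (0 : Form m X k) := fun x₀ => contDiffOn_const (c := 0)
  have h := d_add h0 h0
  rw [add_zero] at h
  exact left_eq_add.mp h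

lemma d_sum {ι : Type*} (s : Finset ι) {a : ι → Form m X k} (ha : ∀ i ∈ s, IsSmooth (a i)) :
    d (∑ i ∈ s, a i) = ∑ i ∈ s, d (a i) := by
  classical
  induction s using Finset.induction_on with
  | empty => exact d_zero
  | insert i s hi ih =>
    have h := fun j hj => ha j (Finset.mem_insert_of_mem hj)
    rw [Finset.sum_insert hi, Finset.sum_insert hi, ← ih h,
      d_add (ha i (Finset.mem_insert_self i s)) (IsSmooth.sum s h)]

variable [IsManifold (𝓡 m) ∞ X]

lemma mdifferentiableAt_symm {x₀ : X} {y : Model m} (hy : y ∈ (extChartAt (𝓡 m) x₀).target) :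
    MDifferentiableAt 𝓘(ℝ, Model m) (𝓡 m) (extChartAt (𝓡 m) x₀).symm y := by
  have := mdifferentiableWithinAt_extChartAt_symm hy
  rwa [modelWithCornersSelf_coe, Set.range_id, mdifferentiableWithinAt_univ] at this

lemma mfderiv_chart_comp_symm {x₀ : X} {y : Model m} (hy : y ∈ (extChartAt (𝓡 m) x₀).target) :
    (mfderiv (𝓡 m) 𝓘(ℝ, Model m) (extChartAt (𝓡 m) x₀) ((extChartAt (𝓡 m) x₀).symm y)).comp
      (mfderiv 𝓘(ℝ, Model m) (𝓡 m) (extChartAt (𝓡 m) x₀).symm y) =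
      ContinuousLinearMap.id ℝ _ := by
  have := mfderiv_extChartAt_comp_mfderivWithin_extChartAt_symm hy
  simpa using this

lemma mfderiv_symm_comp_chart {x₀ : X} {y : Model m} (hy : y ∈ (extChartAt (𝓡 m) x₀).target) :
    (mfderiv 𝓘(ℝ, Model m) (𝓡 m) (extChartAt (𝓡 m) x₀).symm y).comp
    (mfderiv (𝓡 m) 𝓘(ℝ, Model m) (extChartAt (𝓡 m) x₀) ((extChartAt (𝓡 m) x₀).symm y)) =
      ContinuousLinearMap.id ℝ _ := by
  have := mfderivWithin_extChartAt_symm_comp_mfderiv_extChartAt hy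
  simpa using this

lemma fderiv_comp_symm {x₀ : X} {y : Model m} (hy : y ∈ (extChartAt (𝓡 m) x₀).target) {H : X → F}
    (hH : MDifferentiableAt (𝓡 m) 𝓘(ℝ, F) H ((extChartAt (𝓡 m) x₀).symm y)) :
    fderiv ℝ (H ∘ (extChartAt (𝓡 m) x₀).symm) y =
      (dv (m := m) H ((extChartAt (𝓡 m) x₀).symm y)).comp
        (mfderiv 𝓘(ℝ, Model m) (𝓡 m) (extChartAt (𝓡 m) x₀).symm y) := by
  rw [← mfderiv_eq_fderiv, mfderiv_comp y hH (mdifferentiableAt_symm hy)]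
  rfl

lemma fderiv_comp_chart {x₀ x : X} (hx : x ∈ (extChartAt (𝓡 m) x₀).source) {H : X → F}
    (hH : MDifferentiableAt (𝓡 m) 𝓘(ℝ, F) H x) :
    (fderiv ℝ (H ∘ (extChartAt (𝓡 m) x₀).symm) (extChartAt (𝓡 m) x₀ x)).comp
      (mfderiv (𝓡 m) 𝓘(ℝ, Model m) (extChartAt (𝓡 m) x₀) x) = dv (m := m) H x := by
  have hy := (extChartAt (𝓡 m) x₀).map_source hx
  have hH' : MDifferentiableAt (𝓡 m) 𝓘(ℝ, F) H
      ((extChartAt (𝓡 m) x₀).symm (extChartAt (𝓡 m) x₀ x)) := by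
    rwa [(extChartAt (𝓡 m) x₀).left_inv hx]
  have h1 : MDifferentiableAt 𝓘(ℝ, Model m) 𝓘(ℝ, F) (H ∘ (extChartAt (𝓡 m) x₀).symm)
      (extChartAt (𝓡 m) x₀ x) := hH'.comp _ (mdifferentiableAt_symm hy)
  have h2 : MDifferentiableAt (𝓡 m) 𝓘(ℝ, Model m) (extChartAt (𝓡 m) x₀) x :=
    mdifferentiableAt_extChartAt (by simpa using hx)
  have hev : H =ᶠ[𝓝 x] (H ∘ (extChartAt (𝓡 m) x₀).symm) ∘ extChartAt (𝓡 m) x₀ := by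
    filter_upwards [(isOpen_extChartAt_source x₀).mem_nhds hx] with z hz
    simp only [Function.comp_apply, (extChartAt (𝓡 m) x₀).left_inv hz]
  rw [dv, hev.mfderiv_eq, mfderiv_comp x h1 h2, mfderiv_eq_fderiv]
  rfl

lemma inChart_pullE {x₀ : X} {y : Model m} (hy : y ∈ (extChartAt (𝓡 m) x₀).target) {H : X → F}
    (hH : MDifferentiable (𝓡 m) 𝓘(ℝ, F) H) (C : F → F [⋀^Fin k]→L[ℝ] ℂ) :
    inChart (pullE (m := m) H C) x₀ y =
      (C ((H ∘ (extChartAt (𝓡 m) x₀).symm) y)).compContinuousLinearMap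
        (fderiv ℝ (H ∘ (extChartAt (𝓡 m) x₀).symm) y) := by
  rw [fderiv_comp_symm hy (hH _)]
  rfl

lemma contDiffOn_comp_symm {n : ℕ∞} {H : X → F} (hH : ContMDiff (𝓡 m) 𝓘(ℝ, F) n H) (x₀ : X) :
    ContDiffOn ℝ n (H ∘ (extChartAt (𝓡 m) x₀).symm) (extChartAt (𝓡 m) x₀).target := by
  rw [← contMDiffOn_iff_contDiffOn]
  have : IsManifold (𝓡 m) n X := .of_le (n := ∞) (by exact_mod_cast le_top)
  exact hH.comp_contMDiffOn (contMDiffOn_extChartAt_symm x₀)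

lemma isContForm_pullE {H : X → F} (hH : ContMDiff (𝓡 m) 𝓘(ℝ, F) 1 H)
    {C : F → F [⋀^Fin k]→L[ℝ] ℂ} (hC : Continuous C) : IsContForm (pullE (m := m) H C) := by
  intro x₀
  have h1 := contDiffOn_comp_symm (n := 1) hH x₀
  have h2 := h1.continuousOn_fderiv_of_isOpen (isOpen_extChartAt_target (I := 𝓡 m) x₀) le_rfl
  have h3 := hC.comp_continuousOn h1.continuousOn
  refine ContinuousOn.congr (f := fun y =>
      (C ((H ∘ (extChartAt (𝓡 m) x₀).symm) y)).compContinuousLinearMap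
        (fderiv ℝ (H ∘ (extChartAt (𝓡 m) x₀).symm) y)) ?_
    fun y hy => inChart_pullE hy (hH.mdifferentiable one_ne_zero) C
  exact contDiff_compContinuousLinearMap (n := 0).continuous.comp_continuousOn (h3.prodMk h2)

lemma isSmooth_pullE {H : X → F} (hH : ContMDiff (𝓡 m) 𝓘(ℝ, F) ∞ H)
    {C : F → F [⋀^Fin k]→L[ℝ] ℂ} (hC : ContDiff ℝ ∞ C) : IsSmooth (pullE (m := m) H C) := by
  intro x₀
  have h1 := contDiffOn_comp_symm (n := ⊤) hH x₀
  have h2 := h1.fderiv_of_isOpen (m := ∞) (isOpen_extChartAt_target (I := 𝓡 m) x₀) (by simp)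
  have h3 := hC.comp_contDiffOn h1
  refine ContDiffOn.congr (f := fun y =>
      (C ((H ∘ (extChartAt (𝓡 m) x₀).symm) y)).compContinuousLinearMap
        (fderiv ℝ (H ∘ (extChartAt (𝓡 m) x₀).symm) y)) ?_
    fun y hy => inChart_pullE hy (hH.mdifferentiable (by simp)) C
  exact contDiff_compContinuousLinearMap.comp_contDiffOn (h3.prodMk h2)

/-- The exterior derivative commutes with the pullback of forms from a vector space. -/
lemma d_pullE {H : X → F} (hH : ContMDiff (𝓡 m) 𝓘(ℝ, F) ∞ H)
    {C : F → F [⋀^Fin k]→L[ℝ] ℂ} (hC : ContDiff ℝ ∞ C) :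
    d (pullE (m := m) H C) = pullE (m := m) H (extDeriv C) := by
  funext x
  have hx : extChartAt (𝓡 m) x x ∈ (extChartAt (𝓡 m) x).target := mem_extChartAt_target x
  have h1 := contDiffOn_comp_symm (n := ⊤) hH x
  have hev : inChart (pullE (m := m) H C) x =ᶠ[𝓝 (extChartAt (𝓡 m) x x)] fun y =>
      (C ((H ∘ (extChartAt (𝓡 m) x).symm) y)).compContinuousLinearMap
        (fderiv ℝ (H ∘ (extChartAt (𝓡 m) x).symm) y) := by
    filter_upwards [(isOpen_extChartAt_target (I := 𝓡 m) x).mem_nhds hx] with y hy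
    exact inChart_pullE hy (hH.mdifferentiable (by simp)) C
  rw [d, hev.extDeriv_eq, extDeriv_pullback (r := ∞) (hC.differentiable (by simp) _)
    (h1.contDiffAt ((isOpen_extChartAt_target (I := 𝓡 m) x).mem_nhds hx))
    (by rw [minSmoothness_of_isRCLikeNormedField]; exact ENat.LEInfty.out)]
  simp only [Function.comp_apply, extChartAt_to_inv]
  rw [pullE, ← fderiv_comp_chart (mem_extChartAt_source x) (hH.mdifferentiable (by simp) _)]
  rfl

end Charts

/-! ### Coordinate frames and continuity of the inner product -/

section Frames
variable {m : ℕ} {X : Type*} [TopologicalSpace X] [ChartedSpace (EuclideanSpace ℝ (Fin m)) X]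
  {k : ℕ} [IsManifold (𝓡 m) ∞ X]

/-- The `i`-th coordinate vector field of the chart at `x₀`, at the point with coordinates `y`. -/
def coordVec (x₀ : X) (y : Model m) (i : Fin m) :
    TangentSpace (𝓡 m) ((extChartAt (𝓡 m) x₀).symm y) :=
  mfderiv 𝓘(ℝ, Model m) (𝓡 m) (extChartAt (𝓡 m) x₀).symm y (EuclideanSpace.single i (1 : ℝ))

/-- The derivative of the inverse of the chart at `x₀`, as an isomorphism. -/
def coordEquiv {x₀ : X} {y : Model m} (hy : y ∈ (extChartAt (𝓡 m) x₀).target) :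
    Model m ≃L[ℝ] TangentSpace (𝓡 m) ((extChartAt (𝓡 m) x₀).symm y) :=
  ContinuousLinearEquiv.equivOfInverse
    (mfderiv 𝓘(ℝ, Model m) (𝓡 m) (extChartAt (𝓡 m) x₀).symm y)
    (mfderiv (𝓡 m) 𝓘(ℝ, Model m) (extChartAt (𝓡 m) x₀) ((extChartAt (𝓡 m) x₀).symm y))
    (fun v => congrArg (fun A : Model m →L[ℝ] Model m => A v) (mfderiv_chart_comp_symm hy))
    (fun v => congrArg (fun A : TangentSpace (𝓡 m) ((extChartAt (𝓡 m) x₀).symm y) →L[ℝ]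
      TangentSpace (𝓡 m) ((extChartAt (𝓡 m) x₀).symm y) => A v) (mfderiv_symm_comp_chart hy))

/-- The basis of the tangent space formed by the coordinate vectors. -/
def coordBasis {x₀ : X} {y : Model m} (hy : y ∈ (extChartAt (𝓡 m) x₀).target) :
    Module.Basis (Fin m) ℝ (TangentSpace (𝓡 m) ((extChartAt (𝓡 m) x₀).symm y)) :=
  (EuclideanSpace.basisFun (Fin m) ℝ).toBasis.map (coordEquiv hy).toLinearEquiv

lemma coordBasis_apply {x₀ : X} {y : Model m} (hy : y ∈ (extChartAt (𝓡 m) x₀).target)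
    (i : Fin m) : coordBasis hy i = coordVec x₀ y i := by
  have h : (EuclideanSpace.basisFun (Fin m) ℝ).toBasis i = EuclideanSpace.single i (1 : ℝ) := by
    simp
  rw [coordBasis, Module.Basis.map_apply, h]
  rfl

lemma continuousOn_coordVec (x₀ : X) (i : Fin m) :
    ContinuousOn (fun y => (⟨(extChartAt (𝓡 m) x₀).symm y, coordVec x₀ y i⟩ :
      TotalSpace (Model m) (fun x : X => TangentSpace (𝓡 m) x))) (extChartAt (𝓡 m) x₀).target := by
  have h1 := (contMDiffOn_extChartAt_symm (I := 𝓡 m) (n := 1) x₀).continuousOn_tangentMapWithin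
    le_rfl (isOpen_extChartAt_target (I := 𝓡 m) x₀).uniqueMDiffOn
  have h2 : Continuous fun y : Model m => (tangentBundleModelSpaceHomeomorph 𝓘(ℝ, Model m)).symm
      (y, (EuclideanSpace.single i (1 : ℝ) : Model m)) :=
    (Homeomorph.continuous _).comp (by fun_prop)
  have h3 := h1.comp h2.continuousOn (s := (extChartAt (𝓡 m) x₀).target) (fun y hy => hy)
  refine h3.congr fun y hy => ?_
  rw [Function.comp_apply, tangentMapWithin_eq_tangentMap
    ((isOpen_extChartAt_target (I := 𝓡 m) x₀).uniqueMDiffWithinAt hy) (mdifferentiableAt_symm hy)]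
  rfl

variable [RiemannianBundle (fun x : X => TangentSpace (𝓡 m) x)]

/-- The matrix `(g_ij)` of the metric in the chart at `x₀`. -/
def gramMatrix (x₀ : X) (y : Model m) : Matrix (Fin m) (Fin m) ℝ :=
  Matrix.of fun i j => inner ℝ (coordVec x₀ y i) (coordVec x₀ y j)

omit [IsManifold (𝓡 m) ∞ X] in
lemma chartDensity_eq (x₀ : X) (y : Model m) : chartDensity x₀ y = √(gramMatrix x₀ y).det := rfl

lemma det_gramMatrix_pos {x₀ : X} {y : Model m} (hy : y ∈ (extChartAt (𝓡 m) x₀).target) :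
    0 < (gramMatrix x₀ y).det := by
  have h1 : LinearIndependent ℝ (coordVec x₀ y) := by
    have := (coordBasis hy).linearIndependent
    rwa [show ⇑(coordBasis hy) = coordVec x₀ y from funext (coordBasis_apply hy)] at this
  exact (Matrix.posDef_gram_of_linearIndependent h1).det_pos

variable [IsContMDiffRiemannianBundle (𝓡 m) ∞ (EuclideanSpace ℝ (Fin m))
      (fun x : X => TangentSpace (𝓡 m) x)]

/-- A smooth metric is continuous. The smoothness exponent cannot be inferred from the continuity
class, hence the instance is restricted to the exponent `∞`. -/
instance instIsContinuousRiemannianBundle : IsContinuousRiemannianBundle (EuclideanSpace ℝ (Fin m))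
      (fun x : X => TangentSpace (𝓡 m) x) := by
  obtain ⟨g, hg, h⟩ := IsContMDiffRiemannianBundle.exists_contMDiff (IB := 𝓡 m) (n := ∞)
    (F := EuclideanSpace ℝ (Fin m)) (E := fun x : X => TangentSpace (𝓡 m) x)
  exact ⟨g, hg.continuous, h⟩

lemma continuousOn_gramMatrix (x₀ : X) :
    ContinuousOn (gramMatrix (m := m) x₀) (extChartAt (𝓡 m) x₀).target := by
  refine continuousOn_pi.mpr fun i => continuousOn_pi.mpr fun j => ?_
  exact (continuousOn_coordVec x₀ i).inner_bundle (continuousOn_coordVec x₀ j)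

lemma continuousOn_formInner_symm {a b : Form m X k} (ha : IsContForm a) (hb : IsContForm b)
    (x₀ : X) : ContinuousOn (fun y => formInner (a ((extChartAt (𝓡 m) x₀).symm y))
      (b ((extChartAt (𝓡 m) x₀).symm y))) (extChartAt (𝓡 m) x₀).target := by
  have h1 : ContinuousOn (fun y => (gramMatrix (m := m) x₀ y)⁻¹) (extChartAt (𝓡 m) x₀).target := by
    intro y hy
    refine ContinuousAt.comp_continuousWithinAt (continuousAt_matrix_inv _ ?_)
      (continuousOn_gramMatrix x₀ y hy)
    have h4 : (gramMatrix x₀ y).det ≠ 0 := (det_gramMatrix_pos hy).ne'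
    rw [show (Ring.inverse : ℝ → ℝ) = Inv.inv from Ring.inverse_eq_inv']
    exact continuousAt_inv₀ h4
  have h2 : ∀ i j, ContinuousOn (fun y => (gramMatrix (m := m) x₀ y)⁻¹ i j)
      (extChartAt (𝓡 m) x₀).target := fun i j =>
    continuousOn_pi.mp (continuousOn_pi.mp h1 i) j
  have h3 : ∀ {c : Form m X k}, IsContForm c → ∀ I : Fin k → Fin m, ContinuousOn (fun y =>
      inChart c x₀ y fun l => EuclideanSpace.single (I l) (1 : ℝ))
      (extChartAt (𝓡 m) x₀).target := fun hc I =>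
    (ContinuousAlternatingMap.apply ℝ _ _ _).continuous.comp_continuousOn (hc x₀)
  refine ContinuousOn.congr (f := fun y => (k.factorial : ℂ)⁻¹ * ∑ I : Fin k → Fin m,
      ∑ J : Fin k → Fin m, ((∏ l, (gramMatrix (m := m) x₀ y)⁻¹ (I l) (J l) : ℝ) : ℂ) *
        (inChart a x₀ y (fun l => EuclideanSpace.single (I l) (1 : ℝ)) *
          (starRingEnd ℂ) (inChart b x₀ y fun l => EuclideanSpace.single (J l) (1 : ℝ)))) ?_ ?_
  · refine continuousOn_const.mul (continuousOn_finsetSum _ fun I _ =>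
      continuousOn_finsetSum _ fun J _ => ContinuousOn.mul ?_ ((h3 ha I).mul ?_))
    · exact Complex.continuous_ofReal.comp_continuousOn
        (continuousOn_finsetProd _ fun l _ => h2 _ _)
    · exact Complex.continuous_conj.comp_continuousOn (h3 hb J)
  · intro y hy
    have := formInner_eq_gram (coordBasis hy) (a ((extChartAt (𝓡 m) x₀).symm y))
      (b ((extChartAt (𝓡 m) x₀).symm y))
    simp only [coordBasis_apply] at this
    exact this

lemma continuous_formInner {a b : Form m X k} (ha : IsContForm a) (hb : IsContForm b) :
    Continuous fun x => formInner (a x) (b x) := by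
  refine continuous_iff_continuousAt.mpr fun x₀ => ?_
  have h1 := ((continuousOn_formInner_symm ha hb x₀).continuousAt
    ((isOpen_extChartAt_target (I := 𝓡 m) x₀).mem_nhds (mem_extChartAt_target x₀))).comp
    (continuousAt_extChartAt (I := 𝓡 m) x₀)
  refine h1.congr ?_
  filter_upwards [(isOpen_extChartAt_source (I := 𝓡 m) x₀).mem_nhds
    (mem_extChartAt_source x₀)] with z hz
  simp only [Function.comp_apply]
  rw [(extChartAt (𝓡 m) x₀).left_inv hz]

end Frames

/-! ### Smooth forms as finite sums of pullbacks from vector spaces -/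

section Cutoffs
variable {m : ℕ} {X : Type*} [TopologicalSpace X] [T2Space X] [CompactSpace X]
  [ChartedSpace (EuclideanSpace ℝ (Fin m)) X] [IsManifold (𝓡 m) ∞ X] {k : ℕ}

/-- A finite smooth partition of unity `χ`, together with smooth bump functions `b c` that are
equal to `1` around the support of `χ c` and supported in a prescribed neighbourhood of `c`. -/
lemma exists_cutoffs (W : X → Set X) (hW : ∀ x, W x ∈ 𝓝 x) :
    ∃ (t : Finset X) (b : ∀ c : t, SmoothBumpFunction (𝓡 m) (c : X)) (χ : t → X → ℝ),
      (∀ c, tsupport (b c) ⊆ W c) ∧ (∀ c, ContMDiff (𝓡 m) 𝓘(ℝ, ℝ) ∞ (χ c)) ∧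
      (∀ c, ∀ x ∈ tsupport (χ c), ∀ᶠ z in 𝓝 x, b c z = 1) ∧ ∀ x, ∑ c, χ c x = 1 := by
  choose b _ hb using fun x =>
    (SmoothBumpFunction.nhds_basis_tsupport (I := 𝓡 m) x).mem_iff.mp (hW x)
  set V : X → Set X := fun c => interior {x | b c x = 1}
  have hV : ∀ c, c ∈ V c := fun c => mem_interior_iff_mem_nhds.mpr (b c).eventuallyEq_one
  obtain ⟨t, ht⟩ := isCompact_univ.elim_nhds_subcover V
    (fun c _ => isOpen_interior.mem_nhds (hV c))
  obtain ⟨ρ, hρ⟩ := SmoothPartitionOfUnity.exists_isSubordinate (𝓡 m) isClosed_univ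
    (fun c : t => V c) (fun c => isOpen_interior) (fun x hx => by
      obtain ⟨c, hc, hxc⟩ := Set.mem_iUnion₂.mp (ht.2 hx)
      exact Set.mem_iUnion.mpr ⟨⟨c, hc⟩, hxc⟩)
  refine ⟨t, fun c => b c, fun c => ρ c, fun c => hb c, fun c => (ρ c).contMDiff, fun c x hx => ?_,
    fun x => ?_⟩
  · exact mem_interior_iff_mem_nhds.mp (hρ c hx)
  · rw [← finsum_eq_sum_of_fintype]
    exact ρ.sum_eq_one (Set.mem_univ x)

end Cutoffs

section Extension

/-- Extension by zero of a function that vanishes outside a closed subset of its domain. -/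
lemma contDiff_indicator {E F : Type*} [NormedAddCommGroup E] [NormedSpace ℝ E]
    [NormedAddCommGroup F] [NormedSpace ℝ F] {n : WithTop ℕ∞} {U K : Set E} (hU : IsOpen U)
    (hK : IsClosed K) (hKU : K ⊆ U) {v : E → F} (hv : ContDiffOn ℝ n v U)
    (h0 : ∀ y ∈ U, y ∉ K → v y = 0) : ContDiff ℝ n (U.indicator v) := by
  rw [contDiff_iff_contDiffAt]
  intro y
  by_cases hy : y ∈ U
  · refine (hv.contDiffAt (hU.mem_nhds hy)).congr_of_eventuallyEq ?_
    filter_upwards [hU.mem_nhds hy] with z hz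
    rw [Set.indicator_of_mem hz]
  · refine (contDiffAt_const (c := 0)).congr_of_eventuallyEq ?_
    filter_upwards [hK.isOpen_compl.mem_nhds fun h => hy (hKU h)] with z hz
    by_cases hzU : z ∈ U
    · rw [Set.indicator_of_mem hzU, h0 z hzU hz]
    · rw [Set.indicator_of_notMem hzU]

lemma hasCompactSupport_indicator {E F : Type*} [NormedAddCommGroup E]
    [NormedAddCommGroup F] {U K : Set E} (hK : IsCompact K) {v : E → F}
    (h0 : ∀ y ∈ U, y ∉ K → v y = 0) : HasCompactSupport (U.indicator v) := by
  refine HasCompactSupport.intro hK fun y hy => ?_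
  by_cases hyU : y ∈ U
  · rw [Set.indicator_of_mem hyU, h0 y hyU hy]
  · rw [Set.indicator_of_notMem hyU]

variable {m : ℕ} {X : Type*} [TopologicalSpace X] [CompactSpace X]
  [ChartedSpace (EuclideanSpace ℝ (Fin m)) X]

lemma isCompact_image_chart {c : X} {S : Set X} (hS : IsClosed S)
    (hSc : S ⊆ (extChartAt (𝓡 m) c).source) : IsCompact (extChartAt (𝓡 m) c '' S) :=
  hS.isCompact.image_of_continuousOn ((continuousOn_extChartAt c).mono hSc)

omit [CompactSpace X] in
lemma image_chart_subset {c : X} {S : Set X} (hSc : S ⊆ (extChartAt (𝓡 m) c).source) :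
    extChartAt (𝓡 m) c '' S ⊆ (extChartAt (𝓡 m) c).target := by
  rintro _ ⟨x, hx, rfl⟩
  exact (extChartAt (𝓡 m) c).map_source (hSc hx)

omit [CompactSpace X] in
lemma symm_notMem_of_notMem_image {c : X} {S : Set X} {y : Model m}
    (hy : y ∈ (extChartAt (𝓡 m) c).target) (h : y ∉ extChartAt (𝓡 m) c '' S) :
    (extChartAt (𝓡 m) c).symm y ∉ S :=
  fun hS => h ⟨_, hS, (extChartAt (𝓡 m) c).right_inv hy⟩

end Extension

section Representation
variable {m : ℕ} {X : Type*} [TopologicalSpace X] [T2Space X] [CompactSpace X]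
  [ChartedSpace (EuclideanSpace ℝ (Fin m)) X] [IsManifold (𝓡 m) ∞ X] {k : ℕ}

omit [T2Space X] [CompactSpace X] in
lemma inChart_comp_mfderiv (w : Form m X k) {c x : X} (hx : x ∈ (extChartAt (𝓡 m) c).source) :
    (inChart w c (extChartAt (𝓡 m) c x)).compContinuousLinearMap
      (mfderiv (𝓡 m) 𝓘(ℝ, Model m) (extChartAt (𝓡 m) c) x) = w x := by
  obtain ⟨y, hy, rfl⟩ : ∃ y ∈ (extChartAt (𝓡 m) c).target, (extChartAt (𝓡 m) c).symm y = x :=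
    ⟨_, (extChartAt (𝓡 m) c).map_source hx, (extChartAt (𝓡 m) c).left_inv hx⟩
  rw [(extChartAt (𝓡 m) c).right_inv hy, inChart]
  ext v
  have h := mfderiv_symm_comp_chart hy
  have h2 : ∀ u, (mfderiv 𝓘(ℝ, Model m) (𝓡 m) (extChartAt (𝓡 m) c).symm y)
    (mfderiv (𝓡 m) 𝓘(ℝ, Model m) (extChartAt (𝓡 m) c) ((extChartAt (𝓡 m) c).symm y) u) = u :=
    fun u => congrArg (fun A : TangentSpace (𝓡 m) ((extChartAt (𝓡 m) c).symm y) →L[ℝ]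
      TangentSpace (𝓡 m) ((extChartAt (𝓡 m) c).symm y) => A u) h
  exact congrArg (w ((extChartAt (𝓡 m) c).symm y)) (funext fun i => h2 (v i))

/-- On a compact manifold every smooth form is a finite sum of pullbacks of smooth forms on a vector
space under smooth maps. For a partition of unity `χ` with cutoffs `b` as in `exists_cutoffs`, the
form `χ c • w` is the pullback of `(s, y) ↦ s • (b c • w)_y` under `x ↦ (χ c x, b c x • φ x)`, where
`φ` is the chart at `c`: where `χ c` does not vanish, `b c • φ` is equal to `φ` to first order. -/
theorem exists_eq_sum_pullE {w : Form m X k} (hw : IsSmooth w) :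
    ∃ (t : Finset X) (H : t → X → ℝ × Model m)
      (C : t → ℝ × Model m → (ℝ × Model m) [⋀^Fin k]→L[ℝ] ℂ),
      (∀ c, ContMDiff (𝓡 m) 𝓘(ℝ, ℝ × Model m) ∞ (H c)) ∧ (∀ c, ContDiff ℝ ∞ (C c)) ∧
      w = ∑ c, pullE (m := m) (H c) (C c) := by
  obtain ⟨t, b, χ, -, hχ, hb, hsum⟩ := exists_cutoffs (m := m) (X := X) (fun _ => Set.univ)
    (fun _ => univ_mem)
  have hbs : ∀ c : t, tsupport (b c) ⊆ (extChartAt (𝓡 m) (c : X)).source :=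
    fun c => (b c).tsupport_subset_extChartAt_source
  -- `B c` is the coordinate expression of the compactly supported form `b c • w`.
  set B : t → Model m → Model m [⋀^Fin k]→L[ℝ] ℂ := fun c =>
    (extChartAt (𝓡 m) (c : X)).target.indicator fun y =>
      b c ((extChartAt (𝓡 m) (c : X)).symm y) • inChart w c y
  have hB : ∀ c, ContDiff ℝ ∞ (B c) := fun c => by
    refine contDiff_indicator (isOpen_extChartAt_target (I := 𝓡 m) _)
      (isCompact_image_chart (isClosed_tsupport (b c)) (hbs c)).isClosed
      (image_chart_subset (hbs c)) ?_ fun y hy hyK => ?_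
    · exact (contDiffOn_comp_symm (n := ⊤) (b c).contMDiff (c : X)).smul (hw c)
    · rw [image_eq_zero_of_notMem_tsupport (symm_notMem_of_notMem_image hy hyK)]
      exact zero_smul ℝ (inChart w c y)
  set H : t → X → ℝ × Model m := fun c x => (χ c x, b c x • extChartAt (𝓡 m) (c : X) x)
  have hH2 : ∀ c, ContMDiff (𝓡 m) 𝓘(ℝ, Model m) ∞ fun x => b c x • extChartAt (𝓡 m) (c : X) x :=
    fun c => (b c).contMDiff_smul (contMDiffOn_extChartAt (x := (c : X)))
  have hH : ∀ c, ContMDiff (𝓡 m) 𝓘(ℝ, ℝ × Model m) ∞ (H c) := fun c =>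
    (hχ c).prodMk_space (hH2 c)
  refine ⟨t, H, fun c p => p.1 • (B c p.2).compContinuousLinearMap
    (ContinuousLinearMap.snd ℝ ℝ (Model m)), hH, fun c => ?_, ?_⟩
  · exact contDiff_fst.smul (contDiff_compContinuousLinearMap.comp
      (((hB c).comp contDiff_snd).prodMk contDiff_const))
  · funext x
    have key : ∀ c, pullE (m := m) (H c) (fun p => p.1 • (B c p.2).compContinuousLinearMap
        (ContinuousLinearMap.snd ℝ ℝ (Model m))) x = χ c x • w x := fun c => by
      by_cases hx : x ∈ tsupport (χ c)
      · have h1 := hb c x hx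
        have hxs : x ∈ (extChartAt (𝓡 m) (c : X)).source := by
          refine hbs c (subset_tsupport _ ?_)
          rw [Function.mem_support, h1.self_of_nhds]
          exact one_ne_zero
        have h2 : (fun z => b c z • extChartAt (𝓡 m) (c : X) z) =ᶠ[𝓝 x]
            extChartAt (𝓡 m) (c : X) := by
          filter_upwards [h1] with z hz
          rw [hz, one_smul]
        have h3 : (ContinuousLinearMap.snd ℝ ℝ (Model m)).comp (dv (m := m) (H c) x) =
            mfderiv (𝓡 m) 𝓘(ℝ, Model m) (extChartAt (𝓡 m) (c : X)) x := by
          rw [← h2.mfderiv_eq]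
          have h5 : MDifferentiableAt 𝓘(ℝ, ℝ × Model m) 𝓘(ℝ, Model m)
              (ContinuousLinearMap.snd ℝ ℝ (Model m)) (H c x) :=
            (ContinuousLinearMap.snd ℝ ℝ (Model m)).mdifferentiableAt
          have h6 := mfderiv_comp x h5 ((hH c).mdifferentiable (by simp) x)
          rw [ContinuousLinearMap.mfderiv_eq] at h6
          exact h6.symm
        have h4 : B c (extChartAt (𝓡 m) (c : X) x) = inChart w c (extChartAt (𝓡 m) (c : X) x) := by
          simp only [B]
          rw [Set.indicator_of_mem ((extChartAt (𝓡 m) (c : X)).map_source hxs),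
            (extChartAt (𝓡 m) (c : X)).left_inv hxs, h1.self_of_nhds, one_smul]
        rw [← inChart_comp_mfderiv w hxs, ← h3, ← h4]
        simp only [pullE, H]
        rw [h1.self_of_nhds, one_smul]
        rfl
      · have h0 : χ c x = 0 := image_eq_zero_of_notMem_tsupport hx
        simp only [pullE, H]
        rw [h0]
        refine ContinuousAlternatingMap.ext fun v => ?_
        change (0 : ℝ) • (_ : ℂ) = (0 : ℝ) • (_ : ℂ)
        rw [zero_smul, zero_smul]
    have : ∑ c, χ c x • w x = w x := by rw [← Finset.sum_smul, hsum, one_smul]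
    rw [Finset.sum_apply]
    simp only [key, this]
end Representation

/-! ### Smooth approximation of continuously differentiable maps -/

section Mollification
variable {E F : Type*} [NormedAddCommGroup E] [InnerProductSpace ℝ E] [FiniteDimensional ℝ E]
  [MeasurableSpace E] [BorelSpace E]
  [NormedAddCommGroup F] [NormedSpace ℝ F] [CompleteSpace F]

open scoped Convolution in
/-- The sup norm bound for mollification. The factor `3` is an artefact of the deduction from the
estimate of the distance of the mollification to `g`. -/
lemma norm_normed_convolution_le (φ : ContDiffBump (0 : E)) {g : E → F} {M : ℝ}
    (hg : Continuous g) (hM : ∀ y, ‖g y‖ ≤ M) (y : E) :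
    ‖(φ.normed volume ⋆[ContinuousLinearMap.lsmul ℝ ℝ, volume] g) y‖ ≤ 3 * M := by
  have h1 := φ.dist_normed_convolution_le (μ := (volume : Measure E)) (g := g) (x₀ := y)
    (ε := 2 * M) hg.aestronglyMeasurable fun z _ => by
      rw [dist_eq_norm]
      linarith [norm_sub_le (g z) (g y), hM z, hM y]
  rw [dist_eq_norm] at h1
  have h2 := norm_sub_norm_le
    ((φ.normed volume ⋆[ContinuousLinearMap.lsmul ℝ ℝ, volume] g) y) (g y)
  linarith [hM y]

open scoped Convolution in
/-- Mollifications of a compactly supported `C¹` function converge to it pointwise together with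
their derivatives, with uniform bounds. -/
lemma exists_smooth_approx_of_hasCompactSupport {u : E → F} (hu : ContDiff ℝ 1 u)
    (hc : HasCompactSupport u) :
    ∃ v : ℕ → E → F, (∀ n, ContDiff ℝ ∞ (v n)) ∧
      (∀ y, Tendsto (fun n => v n y) atTop (𝓝 (u y))) ∧
      (∀ y, Tendsto (fun n => fderiv ℝ (v n) y) atTop (𝓝 (fderiv ℝ u y))) ∧
      ∃ R, ∀ n y, ‖v n y‖ ≤ R ∧ ‖fderiv ℝ (v n) y‖ ≤ R := by
  set φ : ℕ → ContDiffBump (0 : E) := fun n =>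
    ⟨((n : ℝ) + 2)⁻¹, ((n : ℝ) + 1)⁻¹, by positivity, by gcongr; norm_num⟩
  have hφ : Tendsto (fun n => (φ n).rOut) atTop (𝓝 0) := by
    simpa [φ] using tendsto_one_div_add_atTop_nhds_zero_nat (𝕜 := ℝ)
  have hL : (ContinuousLinearMap.lsmul ℝ ℝ : ℝ →L[ℝ] F →L[ℝ] F).precompR E =
      ContinuousLinearMap.lsmul ℝ ℝ := by
    exact ContinuousLinearMap.ext fun a => ContinuousLinearMap.ext fun T => rfl
  have hfd : ∀ n y, fderiv ℝ ((φ n).normed volume ⋆[ContinuousLinearMap.lsmul ℝ ℝ, volume] u) y =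
      ((φ n).normed volume ⋆[ContinuousLinearMap.lsmul ℝ ℝ, volume] fderiv ℝ u) y := fun n y => by
    have h := (hc.hasFDerivAt_convolution_right (ContinuousLinearMap.lsmul ℝ ℝ)
      ((φ n).continuous_normed (μ := (volume : Measure E))).locallyIntegrable
      (μ := volume) hu y).fderiv
    rw [h, hL]
  have hu' := hu.continuous_fderiv one_ne_zero
  obtain ⟨M₁, hM₁⟩ := hc.exists_bound_of_continuous hu.continuous
  obtain ⟨M₂, hM₂⟩ := (hc.fderiv ℝ).exists_bound_of_continuous hu'
  refine ⟨fun n => (φ n).normed volume ⋆[ContinuousLinearMap.lsmul ℝ ℝ, volume] u, fun n => ?_,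
    fun y => ?_, fun y => ?_, 3 * max M₁ M₂, fun n y => ⟨?_, ?_⟩⟩
  · exact (φ n).hasCompactSupport_normed.contDiff_convolution_left _ (φ n).contDiff_normed
      hu.continuous.locallyIntegrable
  · exact ContDiffBump.convolution_tendsto_right_of_continuous hφ hu.continuous y
  · simp only [hfd]
    exact ContDiffBump.convolution_tendsto_right_of_continuous hφ hu' y
  · exact norm_normed_convolution_le _ hu.continuous (fun z => (hM₁ z).trans (le_max_left _ _)) y
  · rw [hfd]
    exact norm_normed_convolution_le _ hu' (fun z => (hM₂ z).trans (le_max_right _ _)) y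

end Mollification

section Bounds

/-- On a compact space, a locally bounded function is bounded. -/
lemma exists_forall_le_of_eventually {X : Type*} [TopologicalSpace X] [CompactSpace X] {g : X → ℝ}
    (h : ∀ x, ∃ C, ∀ᶠ z in 𝓝 x, g z ≤ C) : ∃ C, 0 ≤ C ∧ ∀ x, g x ≤ C := by
  choose C hC using h
  obtain ⟨t, -, ht⟩ := isCompact_univ.elim_nhds_subcover (fun x => {z | g z ≤ C x})
    (fun x _ => hC x)
  refine ⟨∑ x ∈ t, |C x|, Finset.sum_nonneg fun _ _ => abs_nonneg _, fun z => ?_⟩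
  obtain ⟨x, hx, hz⟩ := Set.mem_iUnion₂.mp (ht (Set.mem_univ z))
  exact (show g z ≤ C x from hz).trans ((le_abs_self _).trans
    (Finset.single_le_sum (f := fun x => |C x|) (fun _ _ => abs_nonneg _) hx))

variable {m : ℕ} {X : Type*} [TopologicalSpace X]
  [ChartedSpace (EuclideanSpace ℝ (Fin m)) X] [IsManifold (𝓡 m) ∞ X]
  [RiemannianBundle (fun x : X => TangentSpace (𝓡 m) x)]
  [IsContMDiffRiemannianBundle (𝓡 m) ∞ (EuclideanSpace ℝ (Fin m))
      (fun x : X => TangentSpace (𝓡 m) x)]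
  {F : Type*} [NormedAddCommGroup F] [NormedSpace ℝ F]

lemma eventually_norm_dv_chart_le (x : X) :
    ∃ C, ∀ᶠ z in 𝓝 x, ‖dv (m := m) (extChartAt (𝓡 m) x) z‖ ≤ C := by
  obtain ⟨C, -, hC⟩ := eventually_norm_mfderiv_extChartAt_lt (𝓡 m) x
  exact ⟨C, hC.mono fun z hz => hz.le⟩

lemma eventually_norm_dv_le {H : X → F} {x : X} (hH : ContMDiffAt (𝓡 m) 𝓘(ℝ, F) 1 H x) :
    ∃ C, ∀ᶠ z in 𝓝 x, ‖dv (m := m) H z‖ ≤ C := by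
  obtain ⟨C, hC⟩ := eventually_norm_dv_chart_le (m := m) x
  have h1 : ContDiffAt ℝ 1 (H ∘ (extChartAt (𝓡 m) x).symm) (extChartAt (𝓡 m) x x) := by
    rw [← contMDiffAt_iff_contDiffAt]
    refine ContMDiffAt.comp _ (by rwa [extChartAt_to_inv]) ?_
    exact (contMDiffOn_extChartAt_symm x).contMDiffAt
      ((isOpen_extChartAt_target (I := 𝓡 m) x).mem_nhds (mem_extChartAt_target x))
  have h2 : ContinuousAt (fderiv ℝ (H ∘ (extChartAt (𝓡 m) x).symm)) (extChartAt (𝓡 m) x x) :=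
    (h1.fderiv_right (m := 0) (by simp)).continuousAt
  have h3 := (h2.norm.comp (continuousAt_extChartAt (I := 𝓡 m) x)).eventually_lt
    (continuousAt_const
      (y := ‖fderiv ℝ (H ∘ (extChartAt (𝓡 m) x).symm) (extChartAt (𝓡 m) x x)‖ + 1))
    (by simp)
  refine ⟨(‖fderiv ℝ (H ∘ (extChartAt (𝓡 m) x).symm) (extChartAt (𝓡 m) x x)‖ + 1) * C, ?_⟩
  filter_upwards [h3, hC, (contMDiffAt_iff_contMDiffAt_nhds (by simp)).mp hH,
    (isOpen_extChartAt_source (I := 𝓡 m) x).mem_nhds (mem_extChartAt_source x)]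
    with z hz hCz hHz hzs
  rw [← fderiv_comp_chart hzs (hHz.mdifferentiableAt one_ne_zero)]
  refine (ContinuousLinearMap.opNorm_comp_le _ (dv (m := m) (extChartAt (𝓡 m) x) z)).trans ?_
  exact mul_le_mul hz.le hCz (norm_nonneg _) (by positivity)

lemma exists_norm_dv_le [CompactSpace X] {H : X → F} (hH : ContMDiff (𝓡 m) 𝓘(ℝ, F) 1 H) :
    ∃ C, 0 ≤ C ∧ ∀ x, ‖dv (m := m) H x‖ ≤ C :=
  exists_forall_le_of_eventually fun x => eventually_norm_dv_le (hH x)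

/-- The derivative of the inverse of the chart at `x₀`, at the point with coordinates `y`. -/
def coordMap (x₀ : X) (y : Model m) :
    Model m →L[ℝ] TangentSpace (𝓡 m) ((extChartAt (𝓡 m) x₀).symm y) :=
  mfderiv 𝓘(ℝ, Model m) (𝓡 m) (extChartAt (𝓡 m) x₀).symm y

lemma eventually_norm_coordMap_le (x : X) :
    ∃ C, ∀ᶠ z in 𝓝 x, ‖coordMap (m := m) x (extChartAt (𝓡 m) x z)‖ ≤ C := by
  obtain ⟨C, -, hC⟩ := eventually_norm_mfderivWithin_symm_extChartAt_comp_lt (𝓡 m) x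
  refine ⟨C, hC.mono fun z hz => ?_⟩
  rw [modelWithCornersSelf_coe, Set.range_id, mfderivWithin_univ] at hz
  exact hz.le

omit [IsContMDiffRiemannianBundle (𝓡 m) ∞ (EuclideanSpace ℝ (Fin m))
      (fun x : X => TangentSpace (𝓡 m) x)] in
lemma norm_le_mul_norm_dv_chart {c p : X} (hp : p ∈ (extChartAt (𝓡 m) c).source)
    (v : TangentSpace (𝓡 m) p) :
    ‖v‖ ≤ ‖coordMap (m := m) c (extChartAt (𝓡 m) c p)‖ *
      ‖dv (m := m) (extChartAt (𝓡 m) c) p v‖ := by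
  obtain ⟨y, hy, rfl⟩ : ∃ y ∈ (extChartAt (𝓡 m) c).target, (extChartAt (𝓡 m) c).symm y = p :=
    ⟨_, (extChartAt (𝓡 m) c).map_source hp, (extChartAt (𝓡 m) c).left_inv hp⟩
  rw [(extChartAt (𝓡 m) c).right_inv hy]
  have h : coordMap (m := m) c y (dv (m := m) (extChartAt (𝓡 m) c) _ v) = v :=
    congrArg (fun A : TangentSpace (𝓡 m) ((extChartAt (𝓡 m) c).symm y) →L[ℝ]
      TangentSpace (𝓡 m) ((extChartAt (𝓡 m) c).symm y) => A v) (mfderiv_symm_comp_chart hy)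
  conv_lhs => rw [← h]
  exact ContinuousLinearMap.le_opNorm _ _

lemma exists_norm_mfderiv_le [CompactSpace X] {f : X → X} (hf : ContMDiff (𝓡 m) (𝓡 m) 1 f) :
    ∃ C, 0 ≤ C ∧ ∀ x, ‖mfderiv (𝓡 m) (𝓡 m) f x‖ ≤ C := by
  refine exists_forall_le_of_eventually fun x => ?_
  obtain ⟨C, hC⟩ := eventually_norm_coordMap_le (m := m) (f x)
  have h1 : ContMDiffAt (𝓡 m) 𝓘(ℝ, Model m) 1 (extChartAt (𝓡 m) (f x) ∘ f) x :=
    contMDiffAt_extChartAt.comp x (hf x)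
  obtain ⟨C', hC'⟩ := eventually_norm_dv_le h1
  refine ⟨C * C', ?_⟩
  have h2 := hf.continuous.continuousAt.eventually hC
  have h3 := hf.continuous.continuousAt.eventually ((isOpen_extChartAt_source (I := 𝓡 m)
    (f x)).mem_nhds (mem_extChartAt_source (f x)))
  filter_upwards [h2, hC', h3] with z hz hz' hzs
  have hC0 : 0 ≤ C := (ContinuousLinearMap.opNorm_nonneg _).trans hz
  refine ContinuousLinearMap.opNorm_le_bound _
    (mul_nonneg hC0 ((ContinuousLinearMap.opNorm_nonneg _).trans hz')) fun v => ?_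
  have h4 : dv (m := m) (extChartAt (𝓡 m) (f x) ∘ f) z v =
      dv (m := m) (extChartAt (𝓡 m) (f x)) (f z) (mfderiv (𝓡 m) (𝓡 m) f z v) := by
    have h5 : MDifferentiableAt (𝓡 m) 𝓘(ℝ, Model m) (extChartAt (𝓡 m) (f x)) (f z) :=
      mdifferentiableAt_extChartAt (by rw [← extChartAt_source (𝓡 m)]; exact hzs)
    rw [dv, mfderiv_comp z h5 (hf.mdifferentiable one_ne_zero z)]
    rfl
  calc ‖mfderiv (𝓡 m) (𝓡 m) f z v‖
      ≤ ‖coordMap (m := m) (f x) (extChartAt (𝓡 m) (f x) (f z))‖ *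
        ‖dv (m := m) (extChartAt (𝓡 m) (f x)) (f z) (mfderiv (𝓡 m) (𝓡 m) f z v)‖ :=
        norm_le_mul_norm_dv_chart hzs _
    _ ≤ C * (C' * ‖v‖) := by
        rw [← h4]
        exact mul_le_mul hz ((ContinuousLinearMap.le_opNorm _ _).trans
          (mul_le_mul_of_nonneg_right hz' (norm_nonneg _))) (norm_nonneg _) hC0
    _ = C * C' * ‖v‖ := by ring
end Bounds

section Approx
variable {m : ℕ} {X : Type*} [TopologicalSpace X]
  [ChartedSpace (EuclideanSpace ℝ (Fin m)) X] [IsManifold (𝓡 m) ∞ X]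
  [RiemannianBundle (fun x : X => TangentSpace (𝓡 m) x)]
  {F : Type*} [NormedAddCommGroup F] [NormedSpace ℝ F]

variable (m) in
/-- The map `H` is a pointwise limit of smooth maps whose derivatives converge pointwise to the
derivative of `H`, such that these maps and their derivatives are uniformly bounded. -/
def HasSmoothApprox (H : X → F) : Prop :=
  ∃ v : ℕ → X → F, (∀ n, ContMDiff (𝓡 m) 𝓘(ℝ, F) ∞ (v n)) ∧
    (∀ x, Tendsto (fun n => v n x) atTop (𝓝 (H x))) ∧
    (∀ x, Tendsto (fun n => dv (m := m) (v n) x) atTop (𝓝 (dv (m := m) H x))) ∧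
    ∃ R, ∀ n x, ‖v n x‖ ≤ R ∧ ‖dv (m := m) (v n) x‖ ≤ R

omit [IsManifold (𝓡 m) ∞ X] [RiemannianBundle (fun x : X => TangentSpace (𝓡 m) x)] in
lemma dv_add {H K : X → F} {x : X} (hH : MDifferentiableAt (𝓡 m) 𝓘(ℝ, F) H x)
    (hK : MDifferentiableAt (𝓡 m) 𝓘(ℝ, F) K x) :
    dv (m := m) (H + K) x = dv (m := m) H x + dv (m := m) K x :=
  mfderiv_add hH hK

omit [IsManifold (𝓡 m) ∞ X] [RiemannianBundle (fun x : X => TangentSpace (𝓡 m) x)] in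
lemma dv_const (c : F) (x : X) : dv (m := m) (fun _ : X => c) x = 0 := mfderiv_const

omit [IsManifold (𝓡 m) ∞ X] in
lemma hasSmoothApprox_zero : HasSmoothApprox m (0 : X → F) := by
  refine ⟨fun _ => 0, fun _ => contMDiff_const, fun x => tendsto_const_nhds,
    fun x => tendsto_const_nhds, 0, fun n x => ⟨by simp, ?_⟩⟩
  rw [show dv (m := m) (0 : X → F) x = 0 from dv_const 0 x]
  exact ContinuousLinearMap.opNorm_zero.le

omit [IsManifold (𝓡 m) ∞ X] in
lemma HasSmoothApprox.add {H K : X → F} (hH : HasSmoothApprox m H) (hK : HasSmoothApprox m K)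
    (hH' : MDifferentiable (𝓡 m) 𝓘(ℝ, F) H) (hK' : MDifferentiable (𝓡 m) 𝓘(ℝ, F) K) :
    HasSmoothApprox m (H + K) := by
  obtain ⟨v, hv, hv0, hv1, R, hR⟩ := hH
  obtain ⟨w, hw, hw0, hw1, S, hS⟩ := hK
  have hd : ∀ n x, dv (m := m) (v n + w n) x = dv (m := m) (v n) x + dv (m := m) (w n) x :=
    fun n x => dv_add ((hv n).mdifferentiable (by simp) x) ((hw n).mdifferentiable (by simp) x)
  refine ⟨fun n => v n + w n, fun n => (hv n).add (hw n), fun x => (hv0 x).add (hw0 x),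
    fun x => ?_, R + S, fun n x => ⟨?_, ?_⟩⟩
  · rw [dv_add (hH' x) (hK' x)]
    simp only [hd]
    exact (hv1 x).add (hw1 x)
  · exact (norm_add_le _ _).trans (add_le_add (hR n x).1 (hS n x).1)
  · rw [hd]
    exact (ContinuousLinearMap.opNorm_add_le _ _).trans (add_le_add (hR n x).2 (hS n x).2)

omit [IsManifold (𝓡 m) ∞ X] in
lemma HasSmoothApprox.sum {ι : Type*} (s : Finset ι) {H : ι → X → F}
    (hH : ∀ i, HasSmoothApprox m (H i)) (hH' : ∀ i, MDifferentiable (𝓡 m) 𝓘(ℝ, F) (H i)) :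
    HasSmoothApprox m (∑ i ∈ s, H i) ∧ MDifferentiable (𝓡 m) 𝓘(ℝ, F) (∑ i ∈ s, H i) := by
  classical
  induction s using Finset.induction_on with
  | empty => exact ⟨hasSmoothApprox_zero, fun x => mdifferentiableAt_const⟩
  | insert i s hi ih =>
    rw [Finset.sum_insert hi]
    exact ⟨(hH i).add ih.1 (hH' i) ih.2, fun x => (hH' i x).add (ih.2 x)⟩

variable [IsContMDiffRiemannianBundle (𝓡 m) ∞ (EuclideanSpace ℝ (Fin m))
      (fun x : X => TangentSpace (𝓡 m) x)] [T2Space X] [CompactSpace X] [CompleteSpace F]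

omit [RiemannianBundle (fun x : X => TangentSpace (𝓡 m) x)] [CompleteSpace F]
  [IsContMDiffRiemannianBundle (𝓡 m) ∞ (EuclideanSpace ℝ (Fin m))
      (fun x : X => TangentSpace (𝓡 m) x)] [CompactSpace X] in
lemma dv_bump_smul_comp_chart {c : X} (b : SmoothBumpFunction (𝓡 m) c) {u : Model m → F}
    (hu : ContDiff ℝ 1 u) {x : X} (hx : x ∈ (extChartAt (𝓡 m) c).source) :
    dv (m := m) (fun z => b z • u (extChartAt (𝓡 m) c z)) x =
      b x • (fderiv ℝ u (extChartAt (𝓡 m) c x)).comp (dv (m := m) (extChartAt (𝓡 m) c) x) +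
        (dv (m := m) b x).smulRight (u (extChartAt (𝓡 m) c x)) := by
  have h1 : MDifferentiableAt (𝓡 m) 𝓘(ℝ, ℝ) b x := b.contMDiff.mdifferentiable (by simp) x
  have h2 : MDifferentiableAt (𝓡 m) 𝓘(ℝ, Model m) (extChartAt (𝓡 m) c) x :=
    mdifferentiableAt_extChartAt (by rw [← extChartAt_source (𝓡 m)]; exact hx)
  have h3 : HasMFDerivAt (𝓡 m) 𝓘(ℝ, F) (u ∘ extChartAt (𝓡 m) c) x
      ((fderiv ℝ u (extChartAt (𝓡 m) c x)).comp (dv (m := m) (extChartAt (𝓡 m) c) x)) :=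
    HasMFDerivAt.comp x ((hu.differentiable one_ne_zero _).hasFDerivAt.hasMFDerivAt) h2.hasMFDerivAt
  have h4 := mvfderiv_smul h1 h3.mdifferentiableAt
  have h5 : dv (m := m) (u ∘ extChartAt (𝓡 m) c) x =
      (fderiv ℝ u (extChartAt (𝓡 m) c x)).comp (dv (m := m) (extChartAt (𝓡 m) c) x) := h3.mfderiv
  rw [← h5]
  exact h4

/-- Smooth approximation of a `C¹` map `K` with support in a chart: `K = b • (u ∘ φ)`, where `φ` is
the chart, `u` is the coordinate expression of `K`, extended by zero, and `b` is a bump function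
that is equal to `1` around the support of `K`. The approximating maps are `b • (v n ∘ φ)`, with
mollifications `v n` of `u`; their supports need not lie in the support of `K`, which is why `b` is
needed. -/
lemma hasSmoothApprox_localized {c : X} (b : SmoothBumpFunction (𝓡 m) c) {C : ℝ}
    (hC : ∀ x ∈ tsupport b, ‖dv (m := m) (extChartAt (𝓡 m) c) x‖ ≤ C) {K : X → F}
    (hK : ContMDiff (𝓡 m) 𝓘(ℝ, F) 1 K)
    (hb : ∀ x ∈ tsupport K, ∀ᶠ z in 𝓝 x, b z = 1) : HasSmoothApprox m K := by
  have hbs : tsupport b ⊆ (extChartAt (𝓡 m) c).source := b.tsupport_subset_extChartAt_source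
  have hKb : tsupport K ⊆ (extChartAt (𝓡 m) c).source := fun x hx => by
    refine hbs (subset_tsupport _ ?_)
    rw [Function.mem_support, (hb x hx).self_of_nhds]
    exact one_ne_zero
  have hcpt := isCompact_image_chart (m := m) (isClosed_tsupport K) hKb
  set u : Model m → F := (extChartAt (𝓡 m) c).target.indicator (K ∘ (extChartAt (𝓡 m) c).symm)
  have h0 : ∀ y ∈ (extChartAt (𝓡 m) c).target, y ∉ extChartAt (𝓡 m) c '' tsupport K →
      (K ∘ (extChartAt (𝓡 m) c).symm) y = 0 := fun y hy hyK =>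
    image_eq_zero_of_notMem_tsupport (f := K) (symm_notMem_of_notMem_image hy hyK)
  have hu : ContDiff ℝ 1 u := contDiff_indicator (isOpen_extChartAt_target (I := 𝓡 m) c)
    hcpt.isClosed
    (image_chart_subset hKb) (contDiffOn_comp_symm (n := 1) hK c) h0
  have huc : HasCompactSupport u := hasCompactSupport_indicator hcpt h0
  obtain ⟨v, hv, hv0, hv1, R, hR⟩ := exists_smooth_approx_of_hasCompactSupport hu huc
  have hK_eq : K = fun z => b z • u (extChartAt (𝓡 m) c z) := by
    funext z
    by_cases hz : z ∈ tsupport K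
    · have hz' := hKb hz
      simp only [u]
      rw [(hb z hz).self_of_nhds, one_smul,
        Set.indicator_of_mem ((extChartAt (𝓡 m) c).map_source hz'), Function.comp_apply,
        (extChartAt (𝓡 m) c).left_inv hz']
    · rw [image_eq_zero_of_notMem_tsupport hz]
      by_cases hz' : z ∈ (extChartAt (𝓡 m) c).source
      · simp only [u]
        rw [Set.indicator_of_mem ((extChartAt (𝓡 m) c).map_source hz'), Function.comp_apply,
          (extChartAt (𝓡 m) c).left_inv hz', image_eq_zero_of_notMem_tsupport hz, smul_zero]
      · rw [image_eq_zero_of_notMem_tsupport fun h => hz' (hbs h), zero_smul]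
  have hout : ∀ (u' : Model m → F) (x : X), x ∉ tsupport b →
      dv (m := m) (fun z => b z • u' (extChartAt (𝓡 m) c z)) x = 0 := fun u' x hx => by
    have : (fun z => b z • u' (extChartAt (𝓡 m) c z)) =ᶠ[𝓝 x] fun _ => (0 : F) := by
      filter_upwards [(isClosed_tsupport b).isOpen_compl.mem_nhds hx] with z hz
      rw [image_eq_zero_of_notMem_tsupport hz, zero_smul]
    rw [dv, this.mfderiv_eq]
    exact dv_const 0 x
  obtain ⟨B, hB0, hB⟩ := exists_norm_dv_le (m := m) (F := ℝ) (H := b) (b.contMDiff.of_le (by simp))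
  have hR0 : 0 ≤ R := (norm_nonneg _).trans (hR 0 0).1
  have hb1 : ∀ x, ‖b x‖ ≤ 1 := fun x => by
    rw [Real.norm_of_nonneg b.nonneg]; exact b.le_one
  rw [hK_eq]
  refine ⟨fun n z => b z • v n (extChartAt (𝓡 m) c z), fun n => ?_, fun x => ?_, fun x => ?_,
    R + (R * |C| + B * R), fun n x => ⟨?_, ?_⟩⟩
  · exact b.contMDiff_smul ((hv n).contMDiff.comp_contMDiffOn (contMDiffOn_extChartAt (x := c)))
  · exact (hv0 _).const_smul _
  · by_cases hx : x ∈ tsupport b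
    · rw [dv_bump_smul_comp_chart b hu (hbs hx)]
      simp only [fun n => dv_bump_smul_comp_chart b ((hv n).of_le (by simp)) (hbs hx)]
      refine Tendsto.add (Tendsto.const_smul ?_ _) ?_
      · exact ((ContinuousLinearMap.compL ℝ (TangentSpace (𝓡 m) x) (Model m) F).flip
          (dv (m := m) (extChartAt (𝓡 m) c) x)).continuous.continuousAt.tendsto.comp (hv1 _)
      · exact (ContinuousLinearMap.smulRightL ℝ (TangentSpace (𝓡 m) x) F
          (dv (m := m) b x)).continuous.continuousAt.tendsto.comp (hv0 _)
    · rw [hout _ x hx]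
      simp only [fun n => hout (v n) x hx]
      exact tendsto_const_nhds
  · rw [norm_smul]
    have := mul_le_mul (hb1 x) (hR n (extChartAt (𝓡 m) c x)).1 (norm_nonneg _) zero_le_one
    nlinarith [mul_nonneg hR0 (abs_nonneg C), mul_nonneg hB0 hR0]
  · by_cases hx : x ∈ tsupport b
    · rw [dv_bump_smul_comp_chart b ((hv n).of_le (by simp)) (hbs hx)]
      refine (ContinuousLinearMap.opNorm_add_le _ _).trans ?_
      have h1 : ‖b x • (fderiv ℝ (v n) (extChartAt (𝓡 m) c x)).comp
          (dv (m := m) (extChartAt (𝓡 m) c) x)‖ ≤ R * |C| := by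
        refine (ContinuousLinearMap.opNorm_smul_le _ _).trans ?_
        refine (mul_le_of_le_one_left (ContinuousLinearMap.opNorm_nonneg _) (hb1 x)).trans ?_
        refine (ContinuousLinearMap.opNorm_comp_le _ _).trans ?_
        exact mul_le_mul (hR n _).2 ((hC x hx).trans (le_abs_self C)) (norm_nonneg _) hR0
      have h2 : ‖(dv (m := m) b x).smulRight (v n (extChartAt (𝓡 m) c x))‖ ≤ B * R := by
        rw [ContinuousLinearMap.norm_smulRight_apply]
        exact mul_le_mul (hB x) (hR n _).1 (norm_nonneg _) hB0
      linarith
    · rw [hout _ x hx]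
      refine ContinuousLinearMap.opNorm_zero.trans_le ?_
      positivity

/-- On a compact manifold, every `C¹` map into a Banach space has smooth approximations. -/
theorem hasSmoothApprox {H : X → F} (hH : ContMDiff (𝓡 m) 𝓘(ℝ, F) 1 H) : HasSmoothApprox m H := by
  choose C hC using fun c : X => eventually_norm_dv_chart_le (m := m) c
  obtain ⟨t, b, χ, hbW, hχ, hb, hsum⟩ := exists_cutoffs (m := m) (X := X) _ hC
  have hK : ∀ c, ContMDiff (𝓡 m) 𝓘(ℝ, F) 1 fun x => χ c x • H x := fun c =>
    ((hχ c).of_le (by simp)).smul hH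
  have h := HasSmoothApprox.sum (m := m) Finset.univ (H := fun c x => χ c x • H x)
    (fun c => hasSmoothApprox_localized (b c) (fun x hx => hbW c hx) (hK c)
      fun x hx => hb c x (tsupport_smul_subset_left _ _ hx))
    fun c => (hK c).mdifferentiable one_ne_zero
  have hHs : (∑ c, fun x => χ c x • H x) = H := by
    funext x
    rw [Finset.sum_apply, ← Finset.sum_smul, hsum, one_smul]
  rw [← hHs]
  exact h.1
end Approx

/-! ### Quasi-invariance of the Riemannian volume under diffeomorphisms -/

section ChartVolume
variable {m : ℕ} {X : Type*} [TopologicalSpace X]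
  [ChartedSpace (EuclideanSpace ℝ (Fin m)) X] [MeasurableSpace X] [BorelSpace X]

lemma measurableSet_preimage_symm (c : X) {S : Set X} (hS : MeasurableSet S) :
    MeasurableSet ((extChartAt (𝓡 m) c).symm ⁻¹' S ∩ (extChartAt (𝓡 m) c).target) := by
  have hT := (isOpen_extChartAt_target (I := 𝓡 m) c).measurableSet
  have h := (continuousOn_iff_continuous_domRestrict.mp
    (continuousOn_extChartAt_symm (I := 𝓡 m) c)).measurable hS
  have h2 := hT.subtype_image h
  convert! h2 using 1
  ext y
  simp [and_comm]

variable [RiemannianBundle (fun x : X => TangentSpace (𝓡 m) x)]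

lemma chartVolume_apply (c : X) {S : Set X} (hS : MeasurableSet S) :
    chartVolume m c S = ∫⁻ y in (extChartAt (𝓡 m) c).symm ⁻¹' S ∩ (extChartAt (𝓡 m) c).target,
      ENNReal.ofReal (chartDensity c y) := by
  have hT := (isOpen_extChartAt_target (I := 𝓡 m) c).measurableSet
  have h1 : AEMeasurable (extChartAt (𝓡 m) c).symm
      (((volume : Measure (Model m)).restrict (extChartAt (𝓡 m) c).target).withDensity
        fun y => ENNReal.ofReal (chartDensity c y)) :=
    ((continuousOn_extChartAt_symm (I := 𝓡 m) c).aemeasurable hT).mono_ac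
      (withDensity_absolutelyContinuous _ _)
  rw [chartVolume, Measure.map_apply_of_aemeasurable h1 hS, withDensity_apply',
    Measure.restrict_restrict' hT]

variable [IsManifold (𝓡 m) ∞ X]

omit [MeasurableSpace X] [BorelSpace X] in
lemma inner_eq_coordMap {c p : X} (hp : p ∈ (extChartAt (𝓡 m) c).source)
    (v w : TangentSpace (𝓡 m) p) :
    inner ℝ v w = inner ℝ
      (coordMap (m := m) c (extChartAt (𝓡 m) c p) (dv (m := m) (extChartAt (𝓡 m) c) p v))
      (coordMap (m := m) c (extChartAt (𝓡 m) c p) (dv (m := m) (extChartAt (𝓡 m) c) p w)) := by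
  obtain ⟨y, hy, rfl⟩ : ∃ y ∈ (extChartAt (𝓡 m) c).target, (extChartAt (𝓡 m) c).symm y = p :=
    ⟨_, (extChartAt (𝓡 m) c).map_source hp, (extChartAt (𝓡 m) c).left_inv hp⟩
  rw [(extChartAt (𝓡 m) c).right_inv hy]
  have h : ∀ v, coordMap (m := m) c y (dv (m := m) (extChartAt (𝓡 m) c) _ v) = v := fun v =>
    congrArg (fun A : TangentSpace (𝓡 m) ((extChartAt (𝓡 m) c).symm y) →L[ℝ]
      TangentSpace (𝓡 m) ((extChartAt (𝓡 m) c).symm y) => A v) (mfderiv_symm_comp_chart hy)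
  rw [h, h]

/-- The derivative at `y` of the coordinate expression of `g` in the charts at `c₁` (on the domain)
and at `c₀` (on the codomain). -/
def transitionDeriv (g : X → X) (c₀ c₁ : X) (y : Model m) : Model m →L[ℝ] Model m :=
  (dv (m := m) (extChartAt (𝓡 m) c₀) (g ((extChartAt (𝓡 m) c₁).symm y))).comp
    ((mfderiv (𝓡 m) (𝓡 m) g ((extChartAt (𝓡 m) c₁).symm y)).comp (coordMap (m := m) c₁ y))

omit [MeasurableSpace X] [BorelSpace X] [RiemannianBundle (fun x : X => TangentSpace (𝓡 m) x)] in
lemma hasFDerivAt_transition {g : X → X} (hg : ContMDiff (𝓡 m) (𝓡 m) 1 g) {c₀ c₁ : X} {y : Model m}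
    (hy : y ∈ (extChartAt (𝓡 m) c₁).target)
    (hgy : g ((extChartAt (𝓡 m) c₁).symm y) ∈ (extChartAt (𝓡 m) c₀).source) :
    HasFDerivAt (fun y => extChartAt (𝓡 m) c₀ (g ((extChartAt (𝓡 m) c₁).symm y)))
      (transitionDeriv g c₀ c₁ y) y := by
  have h1 : MDifferentiableAt (𝓡 m) 𝓘(ℝ, Model m) (extChartAt (𝓡 m) c₀)
      (g ((extChartAt (𝓡 m) c₁).symm y)) :=
    mdifferentiableAt_extChartAt (by rw [← extChartAt_source (𝓡 m)]; exact hgy)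
  have h2 := (hg.mdifferentiable one_ne_zero ((extChartAt (𝓡 m) c₁).symm y)).hasMFDerivAt
  have h3 := (mdifferentiableAt_symm hy).hasMFDerivAt
  exact (h1.hasMFDerivAt.comp y (h2.comp y h3)).hasFDerivAt

omit [MeasurableSpace X] [BorelSpace X] in
open Matrix in
/-- The Jacobian determinant of a map in charts, weighted by the densities of the metric, is bounded
in terms of the norm of the derivative: the square of the left hand side is the Gram determinant
of the images of the coordinate vectors. -/
lemma abs_det_mul_chartDensity_le (g : X → X) {c₀ c₁ : X} {y : Model m}
    (hgy : g ((extChartAt (𝓡 m) c₁).symm y) ∈ (extChartAt (𝓡 m) c₀).source) {K : ℝ} (hK : 0 ≤ K)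
    (hgK : ‖mfderiv (𝓡 m) (𝓡 m) g ((extChartAt (𝓡 m) c₁).symm y)‖ ≤ K) :
    |(transitionDeriv g c₀ c₁ y).det| *
      chartDensity c₀ (extChartAt (𝓡 m) c₀ (g ((extChartAt (𝓡 m) c₁).symm y))) ≤
      √(m.factorial * K ^ (2 * m)) * chartDensity c₁ y := by
  set T := transitionDeriv g c₀ c₁ y
  set B := mfderiv (𝓡 m) (𝓡 m) g ((extChartAt (𝓡 m) c₁).symm y)
  set z := extChartAt (𝓡 m) c₀ (g ((extChartAt (𝓡 m) c₁).symm y))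
  set e := (EuclideanSpace.basisFun (Fin m) ℝ).toBasis
  set M := LinearMap.toMatrix e e T.toLinearMap
  have he : ∀ i, e i = EuclideanSpace.single i (1 : ℝ) := fun i => by simp [e]
  have h1 : (Matrix.of fun i j => inner ℝ (B (coordVec c₁ y i)) (B (coordVec c₁ y j))) =
      Mᵀ * gramMatrix c₀ z * M := by
    ext i j
    have hT : ∀ i, coordMap (m := m) c₀ z (dv (m := m) (extChartAt (𝓡 m) c₀) _
        (B (coordVec c₁ y i))) = ∑ l, M l i • coordVec c₀ z l := fun i => by
      have h2 : dv (m := m) (extChartAt (𝓡 m) c₀) _ (B (coordVec c₁ y i)) = T (e i) := by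
        rw [he]; rfl
      rw [h2]
      have h3 : T (e i) = ∑ l, M l i • e l := by
        conv_lhs => rw [← e.sum_repr (T (e i))]
        simp only [M, LinearMap.toMatrix_apply]
        rfl
      rw [h3, map_sum]
      refine Finset.sum_congr rfl fun l _ => ?_
      rw [map_smul, he]
      rfl
    rw [Matrix.of_apply, inner_eq_coordMap hgy, hT, hT]
    simp only [sum_inner, inner_sum, inner_smul_left, inner_smul_right,
      Matrix.mul_apply, Matrix.transpose_apply, Finset.sum_mul, gramMatrix, Matrix.of_apply]
    refine Finset.sum_congr rfl fun p _ => ?_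
    rw [Finset.mul_sum]
    refine Finset.sum_congr rfl fun q _ => ?_
    simp only [conj_trivial]
    ring
  have h2 := det_gram_map_le (ι := Fin m)
    (by rw [Fintype.card_fin]; exact finrank_euclideanSpace_fin.symm)
    (coordVec c₁ y) B hK hgK
  rw [h1, Fintype.card_fin, Matrix.det_mul, Matrix.det_mul, Matrix.det_transpose] at h2
  have h3 : T.det = M.det := (LinearMap.det_toMatrix e T.toLinearMap).symm
  rw [chartDensity_eq, chartDensity_eq, ← Real.sqrt_sq_eq_abs, ← Real.sqrt_mul (sq_nonneg _),
    ← Real.sqrt_mul (by positivity), h3]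
  refine Real.sqrt_le_sqrt (le_trans (le_of_eq ?_) h2)
  ring

variable [IsContMDiffRiemannianBundle (𝓡 m) ∞ (EuclideanSpace ℝ (Fin m))
      (fun x : X => TangentSpace (𝓡 m) x)] [CompactSpace X]

variable (m) in
/-- Comparison of the volumes in two charts under a diffeomorphism, by the change of variables
formula. For the identity, it shows that the measures `chartVolume` of different charts are
comparable on the intersection of the domains; their equality there is not needed. -/
lemma exists_chartVolume_preimage_le (f : X ≃ₘ^1⟮𝓡 m, 𝓡 m⟯ X) :
    ∃ C : NNReal, ∀ (c₀ c₁ : X) (S : Set X), MeasurableSet S → S ⊆ (extChartAt (𝓡 m) c₁).source →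
      chartVolume m c₀ (f ⁻¹' S) ≤ C * chartVolume m c₁ S := by
  obtain ⟨K, hK0, hK⟩ := exists_norm_mfderiv_le (m := m) f.symm.contMDiff
  refine ⟨Real.toNNReal √(m.factorial * K ^ (2 * m)), fun c₀ c₁ S hS hSc => ?_⟩
  have hf : Measurable f := f.continuous.measurable
  have hg : Measurable f.symm := f.symm.continuous.measurable
  -- The coordinate expression of the inverse of `f`, and the set where it is defined over `S`.
  set τ : Model m → Model m := fun y => extChartAt (𝓡 m) c₀ (f.symm ((extChartAt (𝓡 m) c₁).symm y))
  set A : Set (Model m) := (extChartAt (𝓡 m) c₁).symm ⁻¹'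
    (S ∩ f.symm ⁻¹' (extChartAt (𝓡 m) c₀).source) ∩ (extChartAt (𝓡 m) c₁).target
  have hA : MeasurableSet A := measurableSet_preimage_symm c₁
    (hS.inter (hg (isOpen_extChartAt_source c₀).measurableSet))
  have hτA : τ '' A = (extChartAt (𝓡 m) c₀).symm ⁻¹' (f ⁻¹' S) ∩ (extChartAt (𝓡 m) c₀).target := by
    ext z
    constructor
    · rintro ⟨y, ⟨⟨hyS, hy0⟩, hyT⟩, rfl⟩
      refine ⟨?_, (extChartAt (𝓡 m) c₀).map_source hy0⟩
      simp only [τ, Set.mem_preimage]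
      rw [(extChartAt (𝓡 m) c₀).left_inv hy0, f.apply_symm_apply]
      exact hyS
    · rintro ⟨hzS, hzT⟩
      have h1 := hSc hzS
      refine ⟨extChartAt (𝓡 m) c₁ (f ((extChartAt (𝓡 m) c₀).symm z)), ⟨⟨?_, ?_⟩,
        (extChartAt (𝓡 m) c₁).map_source h1⟩, ?_⟩
      · rw [(extChartAt (𝓡 m) c₁).left_inv h1]; exact hzS
      · rw [(extChartAt (𝓡 m) c₁).left_inv h1, Set.mem_preimage, f.symm_apply_apply]
        exact (extChartAt (𝓡 m) c₀).map_target hzT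
      · simp only [τ]
        rw [(extChartAt (𝓡 m) c₁).left_inv h1, f.symm_apply_apply,
          (extChartAt (𝓡 m) c₀).right_inv hzT]
  have hinj : Set.InjOn τ A := by
    rintro y ⟨⟨-, hy0⟩, hyT⟩ y' ⟨⟨-, hy0'⟩, hyT'⟩ h
    exact (extChartAt (𝓡 m) c₁).symm.injOn hyT hyT'
      (f.symm.injective ((extChartAt (𝓡 m) c₀).injOn hy0 hy0' h))
  rw [chartVolume_apply c₀ (hf hS), ← hτA, lintegral_image_eq_lintegral_abs_det_fderiv_mul volume hA
    (fun y hy => (hasFDerivAt_transition f.symm.contMDiff hy.2 hy.1.2).hasFDerivWithinAt) hinj,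
    chartVolume_apply c₁ hS, ← lintegral_const_mul' _ _ ENNReal.coe_ne_top]
  refine (setLIntegral_mono' hA fun y hy => ?_).trans (lintegral_mono_set
    (Set.inter_subset_inter_left _ (Set.preimage_mono Set.inter_subset_left)))
  rw [← ENNReal.ofReal_mul (abs_nonneg _), ENNReal.ofNNReal_toNNReal,
    ← ENNReal.ofReal_mul (Real.sqrt_nonneg _)]
  exact ENNReal.ofReal_le_ofReal (abs_det_mul_chartDensity_le f.symm hy.1.2 hK0 (hK _))

end ChartVolume

/-! ### Finiteness and positivity of the Riemannian volume -/

section Volume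
variable {m : ℕ} {X : Type*} [TopologicalSpace X]
  [ChartedSpace (EuclideanSpace ℝ (Fin m)) X] [IsManifold (𝓡 m) ∞ X]
  [RiemannianBundle (fun x : X => TangentSpace (𝓡 m) x)]
  [IsContMDiffRiemannianBundle (𝓡 m) ∞ (EuclideanSpace ℝ (Fin m))
      (fun x : X => TangentSpace (𝓡 m) x)]

lemma continuousOn_chartDensity (c : X) :
    ContinuousOn (chartDensity (m := m) c) (extChartAt (𝓡 m) c).target :=
  Real.continuous_sqrt.comp_continuousOn
    (continuous_id.matrix_det.comp_continuousOn (continuousOn_gramMatrix c))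

omit [IsContMDiffRiemannianBundle (𝓡 m) ∞ (EuclideanSpace ℝ (Fin m))
      (fun x : X => TangentSpace (𝓡 m) x)] in
lemma chartDensity_pos {c : X} {y : Model m} (hy : y ∈ (extChartAt (𝓡 m) c).target) :
    0 < chartDensity c y :=
  Real.sqrt_pos.mpr (det_gramMatrix_pos hy)

variable [MeasurableSpace X] [BorelSpace X]

variable (m) in
/-- The volume of a chart domain may be infinite for the measure `chartVolume`, as the density can
be unbounded near the boundary of the target; it is finite on a small neighbourhood of the centre.
-/
lemma exists_isOpen_chartVolume_lt_top (c : X) :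
    ∃ W : Set X, IsOpen W ∧ c ∈ W ∧ W ⊆ (extChartAt (𝓡 m) c).source ∧ chartVolume m c W < ⊤ := by
  have hc := mem_extChartAt_target (I := 𝓡 m) c
  have hT := isOpen_extChartAt_target (I := 𝓡 m) c
  have h1 := (continuousOn_chartDensity (m := m) c).continuousAt (hT.mem_nhds hc)
  obtain ⟨r, hr, hball⟩ := Metric.mem_nhds_iff.mp
    (h1.eventually (gt_mem_nhds (lt_add_one (chartDensity c (extChartAt (𝓡 m) c c)))))
  set R := chartDensity c (extChartAt (𝓡 m) c c) + 1
  have hW : IsOpen ((extChartAt (𝓡 m) c).source ∩ extChartAt (𝓡 m) c ⁻¹' Metric.ball _ r) :=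
    (continuousOn_extChartAt (I := 𝓡 m) c).isOpen_inter_preimage (isOpen_extChartAt_source c)
      (Metric.isOpen_ball (x := extChartAt (𝓡 m) c c) (ε := r))
  refine ⟨_, hW, ⟨mem_extChartAt_source c, Metric.mem_ball_self hr⟩, Set.inter_subset_left, ?_⟩
  rw [chartVolume_apply c hW.measurableSet]
  have h2 : (extChartAt (𝓡 m) c).symm ⁻¹' ((extChartAt (𝓡 m) c).source ∩
      extChartAt (𝓡 m) c ⁻¹' Metric.ball (extChartAt (𝓡 m) c c) r) ∩ (extChartAt (𝓡 m) c).target ⊆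
      Metric.ball (extChartAt (𝓡 m) c c) r := by
    rintro y ⟨⟨-, hy⟩, hyT⟩
    rwa [Set.mem_preimage, (extChartAt (𝓡 m) c).right_inv hyT] at hy
  refine (lintegral_mono_set h2).trans_lt ?_
  refine (setLIntegral_mono measurable_const fun y hy =>
    ENNReal.ofReal_le_ofReal (hball hy).le).trans_lt (b := ∫⁻ _ in _, ENNReal.ofReal R) ?_
  rw [setLIntegral_const]
  exact ENNReal.mul_lt_top ENNReal.ofReal_lt_top measure_ball_lt_top

variable (m X) in
lemma exists_finite_cover_chartVolume_lt_top [CompactSpace X] :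
    ∃ (t : Finset X) (W : X → Set X), (∀ c, IsOpen (W c) ∧ W c ⊆ (extChartAt (𝓡 m) c).source ∧
      chartVolume m c (W c) < ⊤) ∧ ⋃ c ∈ t, W c = Set.univ := by
  choose W hWo hcW hWs hWf using exists_isOpen_chartVolume_lt_top m (X := X)
  obtain ⟨t, ht⟩ := isCompact_univ.elim_nhds_subcover W fun c _ => (hWo c).mem_nhds (hcW c)
  exact ⟨t, W, fun c => ⟨hWo c, hWs c, hWf c⟩, Set.univ_subset_iff.mp ht.2⟩

/-- The volume of a preimage is controlled by finitely many of the measures `chartVolume`. -/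
lemma exists_riemannianVolume_preimage_le [CompactSpace X] {t : Finset X} {W : X → Set X}
    (hW : ∀ c, IsOpen (W c) ∧ W c ⊆ (extChartAt (𝓡 m) c).source)
    (ht : ⋃ c ∈ t, W c = Set.univ) (f : X ≃ₘ^1⟮𝓡 m, 𝓡 m⟯ X) :
    ∃ C : NNReal, ∀ S, MeasurableSet S →
      riemannianVolume m X (f ⁻¹' S) ≤ C * ∑ c ∈ t, chartVolume m c (S ∩ W c) := by
  obtain ⟨C, hC⟩ := exists_chartVolume_preimage_le m f
  refine ⟨C, fun S hS => ?_⟩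
  have hf : Measurable f := f.continuous.measurable
  have hg : Measurable f.symm := f.symm.continuous.measurable
  -- The volume is a supremum in the lattice of measures, so the bound is first stated for measures.
  have h1 : riemannianVolume m X ≤
      (C • ∑ c ∈ t, (chartVolume m c).restrict (W c)).map f.symm := by
    refine iSup_le fun c₀ => Measure.le_iff.mpr fun A hA => ?_
    rw [Measure.map_apply hg hA, Measure.smul_apply, Measure.finsetSum_apply, ENNReal.smul_def,
      smul_eq_mul, Finset.mul_sum]
    have h2 : A ⊆ ⋃ c ∈ t, f ⁻¹' (f.symm ⁻¹' A ∩ W c) := fun x hx => by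
      have h3 : f x ∈ ⋃ c ∈ t, W c := ht ▸ Set.mem_univ _
      simp only [Set.mem_iUnion] at h3 ⊢
      obtain ⟨c, hc, h3⟩ := h3
      refine ⟨c, hc, ?_, h3⟩
      rw [Set.mem_preimage, f.symm_apply_apply]
      exact hx
    refine ((measure_mono h2).trans (measure_biUnion_finset_le t _)).trans
      (Finset.sum_le_sum fun c _ => ?_)
    rw [Measure.restrict_apply (hg hA)]
    exact hC c₀ c _ ((hg hA).inter (hW c).1.measurableSet)
      (Set.inter_subset_right.trans (hW c).2)
  have h4 := h1 (f ⁻¹' S)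
  rw [Measure.map_apply hg (hf hS), Measure.smul_apply, Measure.finsetSum_apply, ENNReal.smul_def,
    smul_eq_mul] at h4
  have h5 : f.symm ⁻¹' (f ⁻¹' S) = S := by
    ext x
    simp
  rw [h5] at h4
  simpa only [Measure.restrict_apply hS] using h4

instance instIsFiniteMeasureRiemannianVolume [CompactSpace X] :
    IsFiniteMeasure (riemannianVolume m X) := by
  obtain ⟨t, W, hW, ht⟩ := exists_finite_cover_chartVolume_lt_top m X
  obtain ⟨C, hC⟩ := exists_riemannianVolume_preimage_le (fun c => ⟨(hW c).1, (hW c).2.1⟩) ht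
    (Diffeomorph.refl (𝓡 m) X 1)
  refine ⟨(hC Set.univ MeasurableSet.univ).trans_lt
    (ENNReal.mul_lt_top ENNReal.coe_lt_top (ENNReal.sum_lt_top.mpr fun c _ => ?_))⟩
  rw [Set.univ_inter]
  exact (hW c).2.2

/-- The push-forward of the Riemannian volume under a `C¹` diffeomorphism has a bounded density. -/
lemma exists_map_riemannianVolume_le [CompactSpace X] (f : X ≃ₘ^1⟮𝓡 m, 𝓡 m⟯ X) :
    ∃ C : NNReal, (riemannianVolume m X).map f ≤ C • riemannianVolume m X := by
  obtain ⟨t, W, hW, ht⟩ := exists_finite_cover_chartVolume_lt_top m X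
  obtain ⟨C, hC⟩ := exists_riemannianVolume_preimage_le (fun c => ⟨(hW c).1, (hW c).2.1⟩) ht f
  refine ⟨C * t.card, Measure.le_iff.mpr fun S hS => ?_⟩
  rw [Measure.map_apply f.continuous.measurable hS, Measure.smul_apply, ENNReal.smul_def,
    smul_eq_mul]
  refine (hC S hS).trans ?_
  rw [ENNReal.coe_mul, mul_assoc, ENNReal.coe_natCast, ← nsmul_eq_mul]
  refine mul_le_mul_right (Finset.sum_le_card_nsmul _ _ _ fun c _ => ?_) _
  exact (measure_mono Set.inter_subset_left).trans (le_iSup (chartVolume (m := m)) c S)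

instance instIsOpenPosMeasureRiemannianVolume : (riemannianVolume m X).IsOpenPosMeasure := by
  refine ⟨fun U hU ⟨c, hc⟩ => ?_⟩
  have h0 : chartVolume m c U ≤ riemannianVolume m X U := le_iSup (chartVolume (m := m)) c U
  refine (lt_of_lt_of_le (pos_iff_ne_zero.mpr fun h => ?_) h0).ne'
  rw [chartVolume_apply c hU.measurableSet] at h
  have hT := isOpen_extChartAt_target (I := 𝓡 m) c
  have ho : IsOpen ((extChartAt (𝓡 m) c).symm ⁻¹' U ∩ (extChartAt (𝓡 m) c).target) := by
    rw [Set.inter_comm]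
    exact (continuousOn_extChartAt_symm c).isOpen_inter_preimage hT hU
  have hne : ((extChartAt (𝓡 m) c).symm ⁻¹' U ∩ (extChartAt (𝓡 m) c).target).Nonempty :=
    ⟨_, by rwa [Set.mem_preimage, extChartAt_to_inv], mem_extChartAt_target c⟩
  rw [setLIntegral_eq_zero_iff' ho.measurableSet ((continuousOn_chartDensity c).mono
    Set.inter_subset_right |>.aemeasurable ho.measurableSet).ennreal_ofReal] at h
  refine (ho.measure_pos volume hne).ne' (measure_mono_null (fun y hy => ?_) h)
  exact fun h => (ENNReal.ofReal_pos.mpr (chartDensity_pos hy.2)).ne' (h hy)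
end Volume

/-! ### Orthogonality of harmonic forms to exact forms -/

set_option synthInstance.maxHeartbeats 200000 in
lemma contDiff_extDeriv {k : ℕ} {E : Type*} [NormedAddCommGroup E] [NormedSpace ℝ E]
    {C : E → E [⋀^Fin k]→L[ℝ] ℂ} (hC : ContDiff ℝ ∞ C) : ContDiff ℝ ∞ (extDeriv C) := by
  have h : ContDiff ℝ ∞ (fderiv ℝ C) := hC.fderiv_right (m := ∞) (by simp)
  exact (ContinuousAlternatingMap.alternatizeUncurryFinCLM ℝ E ℂ (n := k)).contDiff.comp h

section L2
variable {m : ℕ} {X : Type*} [TopologicalSpace X]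
  [ChartedSpace (EuclideanSpace ℝ (Fin m)) X] [IsManifold (𝓡 m) ∞ X]
  [RiemannianBundle (fun x : X => TangentSpace (𝓡 m) x)]
  [IsContMDiffRiemannianBundle (𝓡 m) ∞ (EuclideanSpace ℝ (Fin m))
      (fun x : X => TangentSpace (𝓡 m) x)]
  [MeasurableSpace X] [BorelSpace X] [CompactSpace X] {k : ℕ}

omit [IsManifold (𝓡 m) ∞ X] [IsContMDiffRiemannianBundle (𝓡 m) ∞ (EuclideanSpace ℝ (Fin m))
      (fun x : X => TangentSpace (𝓡 m) x)] [BorelSpace X] [CompactSpace X] in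
lemma l2Inner_conj (a b : Form m X k) : (starRingEnd ℂ) (l2Inner a b) = l2Inner b a := by
  simp only [l2Inner, ← integral_conj, formInner_conj]

omit [IsManifold (𝓡 m) ∞ X] [IsContMDiffRiemannianBundle (𝓡 m) ∞ (EuclideanSpace ℝ (Fin m))
      (fun x : X => TangentSpace (𝓡 m) x)] [BorelSpace X] [CompactSpace X] in
lemma l2Inner_self (a : Form m X k) :
    l2Inner a a = ((∫ x, formNormSq (a x) ∂(riemannianVolume m X) : ℝ) : ℂ) := by
  simp only [l2Inner, formInner_self_eq_formNormSq]
  exact integral_ofReal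

omit [IsManifold (𝓡 m) ∞ X] [IsContMDiffRiemannianBundle (𝓡 m) ∞ (EuclideanSpace ℝ (Fin m))
      (fun x : X => TangentSpace (𝓡 m) x)] [BorelSpace X] [CompactSpace X] in
lemma l2Inner_smul_left (c : ℂ) (a b : Form m X k) : l2Inner (c • a) b = c * l2Inner a b := by
  simp only [l2Inner, Pi.smul_apply, formInner_smul_left]
  exact integral_const_mul _ _

lemma integrable_formInner {a b : Form m X k} (ha : IsContForm a) (hb : IsContForm b) :
    Integrable (fun x => formInner (a x) (b x)) (riemannianVolume m X) :=
  (continuous_formInner ha hb).integrable_of_hasCompactSupport (HasCompactSupport.of_compactSpace _)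

omit [MeasurableSpace X] [BorelSpace X] [CompactSpace X] in
lemma continuous_formNormSq {a : Form m X k} (ha : IsContForm a) :
    Continuous fun x => formNormSq (a x) :=
  Complex.continuous_re.comp (continuous_formInner ha ha)

lemma integrable_formNormSq {a : Form m X k} (ha : IsContForm a) :
    Integrable (fun x => formNormSq (a x)) (riemannianVolume m X) :=
  (continuous_formNormSq ha).integrable_of_hasCompactSupport (HasCompactSupport.of_compactSpace _)

lemma l2Inner_add_left {a a' b : Form m X k} (ha : IsContForm a) (ha' : IsContForm a')
    (hb : IsContForm b) : l2Inner (a + a') b = l2Inner a b + l2Inner a' b := by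
  simp only [l2Inner, Pi.add_apply, formInner_add_left]
  exact integral_add (integrable_formInner ha hb) (integrable_formInner ha' hb)

lemma l2Inner_sum_left {ι : Type*} (s : Finset ι) {a : ι → Form m X k} {b : Form m X k}
    (ha : ∀ i ∈ s, IsContForm (a i)) (hb : IsContForm b) :
    l2Inner (∑ i ∈ s, a i) b = ∑ i ∈ s, l2Inner (a i) b := by
  classical
  induction s using Finset.induction_on with
  | empty =>
    have h := l2Inner_smul_left 0 (0 : Form m X k) b
    rw [zero_mul] at h
    rw [Finset.sum_empty, Finset.sum_empty, ← h]
    congr 1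
    exact (smul_zero (0 : ℂ)).symm
  | insert i s hi ih =>
    rw [Finset.forall_mem_insert] at ha
    rw [Finset.sum_insert hi, Finset.sum_insert hi,
      l2Inner_add_left ha.1 (IsContForm.sum s ha.2) hb, ih ha.2]

lemma eq_zero_of_integral_formNormSq_eq_zero {a : Form m X k} (ha : IsContForm a)
    (h : ∫ x, formNormSq (a x) ∂(riemannianVolume m X) = 0) : a = 0 := by
  rw [integral_eq_zero_iff_of_nonneg (fun x => formNormSq_nonneg _) (integrable_formNormSq ha),
    Continuous.ae_eq_iff_eq _ (continuous_formNormSq ha) continuous_zero] at h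
  exact funext fun x => formNormSq_eq_zero (congrFun h x)

lemma norm_l2Inner_le {a b : Form m X k} (ha : IsContForm a) (hb : IsContForm b) {t : ℝ}
    (ht : 0 < t) : ‖l2Inner a b‖ ≤ t * ∫ x, formNormSq (a x) ∂(riemannianVolume m X) +
      t⁻¹ * ∫ x, formNormSq (b x) ∂(riemannianVolume m X) := by
  have h1 := (integrable_formNormSq ha).const_mul t
  have h2 := (integrable_formNormSq hb).const_mul t⁻¹
  rw [← integral_const_mul, ← integral_const_mul, ← integral_add h1 h2]
  exact norm_integral_le_of_norm_le (h1.add h2) (ae_of_all _ fun x => norm_formInner_le _ _ ht)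

/-- A harmonic form is orthogonal to the smooth exact forms. With `σ = d^* w`, harmonicity reads
`d^* d w = - d σ`, and pairing with `w` gives `‖d w‖² = - ‖σ‖²`, whence `σ = 0`. -/
lemma IsHarmonic.l2Inner_d {w : Form m X (k + 1)} (hw : IsHarmonic w) {β : Form m X k}
    (hβ : IsSmooth β) : l2Inner (d β) w = 0 := by
  obtain ⟨hws, σ, ρ, ⟨hσ, hσ'⟩, ⟨-, hρ⟩, h0⟩ := hw
  have hρσ : ρ = (-1 : ℂ) • d σ :=
    (eq_neg_of_add_eq_zero_left h0.symm).trans (neg_one_smul ℂ (d σ)).symm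
  have h1 := hρ w hws
  rw [← l2Inner_conj ρ w, hρσ, l2Inner_smul_left, hσ' σ hσ, l2Inner_self, l2Inner_self] at h1
  have h2 : ∫ x, formNormSq (d w x) ∂(riemannianVolume m X) =
      -∫ x, formNormSq (σ x) ∂(riemannianVolume m X) := by
    have := congrArg Complex.re h1
    simpa using this
  have h3 : 0 ≤ ∫ x, formNormSq (d w x) ∂(riemannianVolume m X) :=
    integral_nonneg fun x => formNormSq_nonneg _
  have h4 : 0 ≤ ∫ x, formNormSq (σ x) ∂(riemannianVolume m X) :=
    integral_nonneg fun x => formNormSq_nonneg _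
  have h5 : σ = 0 := eq_zero_of_integral_formNormSq_eq_zero hσ.isContForm (by linarith)
  have h6 : σ = (0 : ℂ) • σ := by rw [h5]; exact (smul_zero (A := Form m X k) (0 : ℂ)).symm
  rw [hσ' β hβ, ← l2Inner_conj, h6, l2Inner_smul_left, zero_mul, map_zero]

variable [T2Space X]

omit [RiemannianBundle (fun x : X => TangentSpace (𝓡 m) x)]
  [IsContMDiffRiemannianBundle (𝓡 m) ∞ (EuclideanSpace ℝ (Fin m))
      (fun x : X => TangentSpace (𝓡 m) x)] [MeasurableSpace X] [BorelSpace X] in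
lemma IsSmooth.isContForm_pullback {a : Form m X k} (ha : IsSmooth a) {f : X → X}
    (hf : ContMDiff (𝓡 m) (𝓡 m) 1 f) : IsContForm (pullback f a) := by
  obtain ⟨t, H, C, hH, hC, rfl⟩ := exists_eq_sum_pullE ha
  rw [pullback_sum]
  refine IsContForm.sum _ fun c _ => ?_
  rw [pullback_pullE hf ((hH c).of_le (by simp))]
  exact isContForm_pullE (((hH c).of_le (by simp)).comp hf) (hC c).continuous

omit [RiemannianBundle (fun x : X => TangentSpace (𝓡 m) x)]
  [IsContMDiffRiemannianBundle (𝓡 m) ∞ (EuclideanSpace ℝ (Fin m))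
      (fun x : X => TangentSpace (𝓡 m) x)] [MeasurableSpace X] [BorelSpace X] in
lemma IsSmooth.d {a : Form m X k} (ha : IsSmooth a) : IsSmooth (d a) := by
  obtain ⟨t, H, C, hH, hC, rfl⟩ := exists_eq_sum_pullE ha
  rw [d_sum _ fun c _ => isSmooth_pullE (hH c) (hC c)]
  refine IsSmooth.sum _ fun c _ => ?_
  rw [d_pullE (hH c) (hC c)]
  exact isSmooth_pullE (hH c) (contDiff_extDeriv (hC c))

omit [IsManifold (𝓡 m) ∞ X] [IsContMDiffRiemannianBundle (𝓡 m) ∞ (EuclideanSpace ℝ (Fin m))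
      (fun x : X => TangentSpace (𝓡 m) x)] [MeasurableSpace X] [BorelSpace X] [CompactSpace X]
      [T2Space X] in
lemma tendsto_formInner_pullE {F : Type*} [NormedAddCommGroup F] [NormedSpace ℝ F]
    {D : F → F [⋀^Fin k]→L[ℝ] ℂ} (hD : Continuous D) {v : ℕ → X → F} {H : X → F} {x : X}
    (h0 : Tendsto (fun n => v n x) atTop (𝓝 (H x)))
    (h1 : Tendsto (fun n => dv (m := m) (v n) x) atTop (𝓝 (dv (m := m) H x))) (b : Form m X k) :
    Tendsto (fun n => formInner (pullE (m := m) (v n) D x) (b x)) atTop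
      (𝓝 (formInner (pullE (m := m) H D x) (b x))) := by
  refine (tendsto_finsetSum _ fun I _ => Tendsto.mul_const _ ?_).const_mul _
  have h2 : Tendsto (fun n => (D (v n x), fun i => dv (m := m) (v n) x
      (stdOrthonormalBasis ℝ (TangentSpace (𝓡 m) x) (I i)))) atTop
      (𝓝 (D (H x), fun i => dv (m := m) H x
        (stdOrthonormalBasis ℝ (TangentSpace (𝓡 m) x) (I i)))) :=
    ((hD.tendsto _).comp h0).prodMk_nhds (tendsto_pi_nhds.mpr fun i =>
      ((continuous_eval_const
        (stdOrthonormalBasis ℝ (TangentSpace (𝓡 m) x) (I i))).tendsto _).comp h1)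
  have h3 : Continuous fun p : (F [⋀^Fin k]→L[ℝ] ℂ) × (Fin k → F) => p.1 p.2 := by fun_prop
  exact (h3.tendsto _).comp h2

/-- If a continuous form `w` is orthogonal to the smooth exact forms, it is orthogonal to `H^* dC`
for a `C¹` map `H` into a vector space, by approximation of `H`. The form `H^* C` itself need not
be differentiable. -/
lemma l2Inner_pullE_eq_zero {F : Type*} [NormedAddCommGroup F] [NormedSpace ℝ F]
    [FiniteDimensional ℝ F] {H : X → F} (hH : ContMDiff (𝓡 m) 𝓘(ℝ, F) 1 H)
    {C : F → F [⋀^Fin k]→L[ℝ] ℂ} (hC : ContDiff ℝ ∞ C) {w : Form m X (k + 1)} (hw : IsContForm w)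
    (hort : ∀ β : Form m X k, IsSmooth β → l2Inner (d β) w = 0) :
    l2Inner (pullE (m := m) H (extDeriv C)) w = 0 := by
  have := FiniteDimensional.complete ℝ F
  have := FiniteDimensional.proper_real F
  have hD := (contDiff_extDeriv hC).continuous
  obtain ⟨v, hv, h0, h1, R, hR⟩ := hasSmoothApprox hH
  obtain ⟨B, hB⟩ := (isCompact_closedBall (0 : F) R).exists_bound_of_continuousOn hD.continuousOn
  have h2 : Tendsto (fun n => l2Inner (pullE (m := m) (v n) (extDeriv C)) w) atTop
      (𝓝 (l2Inner (pullE (m := m) H (extDeriv C)) w)) := by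
    have hb := (integrable_const ((m : ℝ) ^ (k + 1) * (B * R ^ (k + 1)) ^ 2)
      (μ := riemannianVolume m X)).add (integrable_formNormSq hw)
    refine tendsto_integral_of_dominated_convergence _ (fun n => ?_) hb
      (fun n => ae_of_all _ fun x => ?_)
      (ae_of_all _ fun x => tendsto_formInner_pullE hD (h0 x) (h1 x) w)
    · exact (integrable_formInner (isContForm_pullE ((hv n).of_le (by simp)) hD) hw).1
    · have hR0 : 0 ≤ R := (norm_nonneg _).trans (hR n x).1
      refine (norm_formInner_le _ _ one_pos).trans ?_
      rw [one_mul, inv_one, one_mul]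
      refine add_le_add_left ((formNormSq_comp_le_of_norm_le _ _ (hR n x).2).trans ?_) _
      rw [show Module.finrank ℝ (TangentSpace (𝓡 m) x) = m from finrank_euclideanSpace_fin]
      have := hB (v n x) (mem_closedBall_zero_iff.mpr (hR n x).1)
      change _ ≤ (m : ℝ) ^ (k + 1) * (B * R ^ (k + 1)) ^ 2
      gcongr
  have h3 : ∀ n, l2Inner (pullE (m := m) (v n) (extDeriv C)) w = 0 := fun n => by
    rw [← d_pullE (hv n) hC]
    exact hort _ (isSmooth_pullE (hv n) hC)
  simp only [h3] at h2
  exact tendsto_nhds_unique h2 tendsto_const_nhds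

/-- If a continuous form `w` is orthogonal to the smooth exact forms, it is orthogonal to their
pullbacks under `C¹` maps. -/
theorem l2Inner_pullback_d {f : X → X} (hf : ContMDiff (𝓡 m) (𝓡 m) 1 f) {w : Form m X (k + 1)}
    (hw : IsContForm w) (hort : ∀ β : Form m X k, IsSmooth β → l2Inner (d β) w = 0)
    {β : Form m X k} (hβ : IsSmooth β) : l2Inner (pullback f (d β)) w = 0 := by
  obtain ⟨t, H, C, hH, hC, rfl⟩ := exists_eq_sum_pullE hβ
  have hH1 : ∀ c, ContMDiff (𝓡 m) 𝓘(ℝ, ℝ × Model m) 1 (H c) := fun c => (hH c).of_le (by simp)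
  have h : ∀ c, pullback f (d (pullE (m := m) (H c) (C c))) =
      pullE (m := m) (H c ∘ f) (extDeriv (C c)) := fun c => by
    rw [d_pullE (hH c) (hC c), pullback_pullE hf (hH1 c)]
  rw [d_sum _ fun c _ => isSmooth_pullE (hH c) (hC c), pullback_sum]
  simp only [h]
  rw [l2Inner_sum_left _ (fun c _ => isContForm_pullE ((hH1 c).comp hf)
    (contDiff_extDeriv (hC c)).continuous) hw]
  exact Finset.sum_eq_zero fun c _ => l2Inner_pullE_eq_zero ((hH1 c).comp hf) (hC c) hw hort
end L2

/-! ### Pullback of square integrable forms by iterates -/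

section PullbackBounds
variable {m : ℕ} {X : Type*} [TopologicalSpace X]
  [ChartedSpace (EuclideanSpace ℝ (Fin m)) X] [IsManifold (𝓡 m) ∞ X]
  [RiemannianBundle (fun x : X => TangentSpace (𝓡 m) x)] {k : ℕ}

omit [IsManifold (𝓡 m) ∞ X] [RiemannianBundle (fun x : X => TangentSpace (𝓡 m) x)] in
lemma finrank_tangentSpace (x : X) : Module.finrank ℝ (TangentSpace (𝓡 m) x) = m :=
  finrank_euclideanSpace_fin

omit [IsManifold (𝓡 m) ∞ X] in
lemma formNormSq_pullback_le (g : X → X) (a : Form m X k) (x : X) :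
    formNormSq (pullback g a x) ≤
      pullbackConst m k * wedgeNorm m k g x ^ 2 * formNormSq (a (g x)) := by
  have h0 : Module.finrank ℝ (TangentSpace (𝓡 m) x) = Module.finrank ℝ (TangentSpace (𝓡 m) (g x)) :=
    (finrank_tangentSpace x).trans (finrank_tangentSpace (g x)).symm
  have h := formNormSq_comp_le (V := TangentSpace (𝓡 m) x) (W := TangentSpace (𝓡 m) (g x)) h0
    (a (g x)) (mfderiv (𝓡 m) (𝓡 m) g x)
  rwa [finrank_tangentSpace] at h

lemma pullbackConst_nonneg (n k : ℕ) : 0 ≤ pullbackConst n k := by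
  unfold pullbackConst
  positivity

omit [IsManifold (𝓡 m) ∞ X] in
lemma wedgeNorm_comp_le (k : ℕ) {f g : X → X} (hf : ContMDiff (𝓡 m) (𝓡 m) 1 f)
    (hg : ContMDiff (𝓡 m) (𝓡 m) 1 g) (x : X) :
    wedgeNorm m k (f ∘ g) x ≤ wedgeNorm m k f (g x) * wedgeNorm m k g x := by
  rw [wedgeNorm, mfderiv_comp x (hf.mdifferentiable one_ne_zero _)
    (hg.mdifferentiable one_ne_zero _)]
  exact wedgeOpNorm_comp_le k _ _

omit [IsManifold (𝓡 m) ∞ X] in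
lemma wedgeNorm_pos (hkm : k ≤ m) (g : X ≃ₘ^1⟮𝓡 m, 𝓡 m⟯ X) (x : X) : 0 < wedgeNorm m k g x := by
  refine wedgeOpNorm_pos (hkm.trans_eq (finrank_tangentSpace x).symm) ?_
  have h := (g.mfderivToContinuousLinearEquiv one_ne_zero x).injective
  rwa [← ContinuousLinearEquiv.coe_coe, g.mfderivToContinuousLinearEquiv_coe] at h

omit [IsManifold (𝓡 m) ∞ X] [RiemannianBundle (fun x : X => TangentSpace (𝓡 m) x)] in
lemma exists_coe_eq_iterate (f : X ≃ₘ^1⟮𝓡 m, 𝓡 m⟯ X) (n : ℕ) :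
    ∃ g : X ≃ₘ^1⟮𝓡 m, 𝓡 m⟯ X, ⇑g = f^[n] := by
  induction n with
  | zero => exact ⟨Diffeomorph.refl _ _ _, rfl⟩
  | succ n ih =>
    obtain ⟨g, hg⟩ := ih
    exact ⟨f.trans g, by rw [Diffeomorph.coe_trans, hg, Function.iterate_succ]⟩

variable [IsContMDiffRiemannianBundle (𝓡 m) ∞ (EuclideanSpace ℝ (Fin m))
      (fun x : X => TangentSpace (𝓡 m) x)] [CompactSpace X]

lemma exists_wedgeNorm_le (k : ℕ) {g : X → X} (hg : ContMDiff (𝓡 m) (𝓡 m) 1 g) :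
    ∃ B, ∀ x, wedgeNorm m k g x ≤ B := by
  obtain ⟨C, hC0, hC⟩ := exists_norm_mfderiv_le hg
  refine ⟨m.choose k * √(k.factorial * C ^ (2 * k)), fun x => ?_⟩
  have h := wedgeOpNorm_le k _ hC0 (hC x)
  rwa [finrank_tangentSpace] at h

lemma bddAbove_log_wedgeNorm (hkm : k ≤ m) (g : X ≃ₘ^1⟮𝓡 m, 𝓡 m⟯ X) :
    BddAbove (Set.range fun x => Real.log (wedgeNorm m k g x)) := by
  obtain ⟨B, hB⟩ := exists_wedgeNorm_le k g.contMDiff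
  refine ⟨Real.log B, ?_⟩
  rintro - ⟨x, rfl⟩
  exact Real.log_le_log (wedgeNorm_pos hkm g x) (hB x)

variable [MeasurableSpace X] [BorelSpace X]

omit [CompactSpace X] in
lemma integral_formNormSq_eq {a : Form m X k} (ha : IsContForm a) :
    ∫ x, formNormSq (a x) ∂(riemannianVolume m X) = (l2NormSq a).toReal :=
  integral_eq_lintegral_of_nonneg_ae (ae_of_all _ fun _ => formNormSq_nonneg _)
    (continuous_formNormSq ha).aestronglyMeasurable

/-- The pullback under a `C¹` diffeomorphism is bounded on `L²`. -/
lemma exists_l2NormSq_pullback_le (k : ℕ) (g : X ≃ₘ^1⟮𝓡 m, 𝓡 m⟯ X) :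
    ∃ K : NNReal, ∀ a : Form m X k, IsContForm a →
      l2NormSq (pullback g a) ≤ K * l2NormSq a := by
  obtain ⟨B, hB⟩ := exists_wedgeNorm_le k g.contMDiff
  obtain ⟨C, hC⟩ := exists_map_riemannianVolume_le g
  refine ⟨Real.toNNReal (pullbackConst m k * B ^ 2) * C, fun a ha => ?_⟩
  have hm : Measurable fun x => ENNReal.ofReal (formNormSq (a x)) :=
    (continuous_formNormSq ha).measurable.ennreal_ofReal
  calc l2NormSq (pullback g a)
      ≤ ∫⁻ x, ENNReal.ofReal (pullbackConst m k * B ^ 2) * ENNReal.ofReal (formNormSq (a (g x)))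
          ∂(riemannianVolume m X) := by
        refine lintegral_mono fun x => ?_
        rw [← ENNReal.ofReal_mul (mul_nonneg (pullbackConst_nonneg _ _) (sq_nonneg _))]
        refine ENNReal.ofReal_le_ofReal ((formNormSq_pullback_le g a x).trans ?_)
        have := hB x
        have h0 : 0 ≤ wedgeNorm m k g x := wedgeOpNorm_nonneg _ _
        have h1 := pullbackConst_nonneg m k
        have h2 := formNormSq_nonneg (a (g x))
        gcongr
    _ = ENNReal.ofReal (pullbackConst m k * B ^ 2) *
          ∫⁻ x, ENNReal.ofReal (formNormSq (a x)) ∂((riemannianVolume m X).map g) := by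
        rw [lintegral_const_mul' _ _ ENNReal.ofReal_ne_top,
          lintegral_map hm g.continuous.measurable]
    _ ≤ ENNReal.ofReal (pullbackConst m k * B ^ 2) *
          ∫⁻ x, ENNReal.ofReal (formNormSq (a x)) ∂(C • riemannianVolume m X) := by
        gcongr
    _ = _ := by
        rw [lintegral_smul_measure, ENNReal.coe_mul, mul_assoc]
        rfl

variable [T2Space X]

/-- The orthogonality of `l2Inner_pullback_d` extends to pullbacks of continuous forms in the
`L²`-closure of the exact forms, if the pullback is by a diffeomorphism. -/
lemma l2Inner_pullback_eq_zero_of_closure (g : X ≃ₘ^1⟮𝓡 m, 𝓡 m⟯ X) {a w : Form m X (k + 1)}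
    (ha : IsContForm a) (hga : IsContForm (pullback g a))
    (hcl : ∀ ε : ℝ≥0∞, 0 < ε → ∃ θ : Form m X (k + 1), IsExact θ ∧ l2NormSq (a - θ) < ε)
    (hw : IsContForm w) (hort : ∀ β : Form m X k, IsSmooth β → l2Inner (d β) w = 0) :
    l2Inner (pullback g a) w = 0 := by
  obtain ⟨K, hK⟩ := exists_l2NormSq_pullback_le (k + 1) g
  set N := ∫ x, formNormSq (w x) ∂(riemannianVolume m X)
  have key : ∀ t : ℝ, 0 < t → ‖l2Inner (pullback g a) w‖ ≤ t⁻¹ * (1 + N) := fun t ht => by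
    have hK0 : (0 : ℝ) < K + 1 := by positivity
    -- With this error, both terms in `norm_l2Inner_le` are of order `t⁻¹`.
    obtain ⟨θ, ⟨β, hβ, rfl⟩, hθ⟩ := hcl (ENNReal.ofReal ((t ^ 2)⁻¹ * ((K : ℝ) + 1)⁻¹))
      (ENNReal.ofReal_pos.mpr (by positivity))
    have hsub : ∀ b c : Form m X (k + 1), b - c = b + (-1 : ℂ) • c := fun b c =>
      (sub_eq_add_neg b c).trans (congrArg (b + ·) (neg_one_smul ℂ c).symm)
    rw [hsub] at hθ
    have h1 : IsContForm (a + (-1 : ℂ) • d β) := ha.add (hβ.d.isContForm.smul _)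
    have h2 : pullback g (a + (-1 : ℂ) • d β) = pullback g a + (-1 : ℂ) • pullback g (d β) := rfl
    have h3 : IsContForm (pullback g (d β)) := hβ.d.isContForm_pullback g.contMDiff
    have h4 : IsContForm (pullback g (a + (-1 : ℂ) • d β)) := h2 ▸ hga.add (h3.smul _)
    have h5 : l2Inner (pullback g (a + (-1 : ℂ) • d β)) w = l2Inner (pullback g a) w := by
      rw [h2, l2Inner_add_left hga (h3.smul _) hw, l2Inner_smul_left,
        l2Inner_pullback_d g.contMDiff hw hort hβ, mul_zero, add_zero]
    have h6 := norm_l2Inner_le h4 hw ht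
    rw [h5, integral_formNormSq_eq h4] at h6
    have h7 : (l2NormSq (pullback g (a + (-1 : ℂ) • d β))).toReal ≤ (t ^ 2)⁻¹ := by
      refine ENNReal.toReal_le_of_le_ofReal (by positivity) ((hK _ h1).trans
        ((mul_le_mul_right hθ.le _).trans ?_))
      rw [← ENNReal.ofReal_coe_nnreal, ← ENNReal.ofReal_mul (by positivity)]
      refine ENNReal.ofReal_le_ofReal ?_
      rw [mul_left_comm, ← div_eq_mul_inv]
      exact mul_le_of_le_one_right (by positivity) ((div_le_one hK0).mpr (by linarith))
    have h8 : t * (t ^ 2)⁻¹ = t⁻¹ := by field_simp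
    calc _ ≤ _ := h6
      _ ≤ t * (t ^ 2)⁻¹ + t⁻¹ * N := by gcongr
      _ = _ := by rw [h8]; ring
  have h0 : Tendsto (fun t : ℝ => t⁻¹ * (1 + N)) atTop (𝓝 (0 * (1 + N))) :=
    tendsto_inv_atTop_zero.mul_const _
  rw [zero_mul] at h0
  exact norm_le_zero_iff.mp (ge_of_tendsto h0 ((eventually_gt_atTop 0).mono key))

/-- The growth of `⟪(f^n)^* w, w⟫` is determined by the class of `f^* w` modulo the closure of the
exact forms. -/
lemma l2Inner_pullback_iterate (f : X ≃ₘ^1⟮𝓡 m, 𝓡 m⟯ X) {w a : Form m X (k + 1)} {μ : ℂ}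
    (hw : IsSmooth w) (hort : ∀ β : Form m X k, IsSmooth β → l2Inner (d β) w = 0)
    (hcl : ∀ ε : ℝ≥0∞, 0 < ε → ∃ θ : Form m X (k + 1), IsExact θ ∧ l2NormSq (a - θ) < ε)
    (heq : ∀ᵐ x ∂(riemannianVolume m X), pullback f w x = μ • w x + a x) (n : ℕ) :
    l2Inner (pullback f^[n] w) w = μ ^ n * l2Inner w w := by
  -- The form `a` is only known almost everywhere; it is replaced by its continuous representative.
  set a' : Form m X (k + 1) := pullback f w + (-μ) • w with ha'
  have hf : ContMDiff (𝓡 m) (𝓡 m) 1 f := f.contMDiff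
  have hca' : IsContForm a' := (hw.isContForm_pullback hf).add (hw.isContForm.smul _)
  have hae : ∀ᵐ x ∂(riemannianVolume m X), a' x = a x := heq.mono fun x hx => by
    refine ContinuousAlternatingMap.ext fun v => ?_
    have h1 : pullback f w x v = μ * w x v + a x v := congrArg (fun b => b v) hx
    change pullback f w x v + (-μ) * w x v = a x v
    rw [h1]
    ring
  have hcl' : ∀ ε : ℝ≥0∞, 0 < ε → ∃ θ : Form m X (k + 1), IsExact θ ∧ l2NormSq (a' - θ) < ε :=
    fun ε hε => by
      obtain ⟨θ, hθ, h⟩ := hcl ε hε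
      refine ⟨θ, hθ, lt_of_eq_of_lt (lintegral_congr_ae (hae.mono fun x hx => ?_)) h⟩
      have h1 : ∀ b : Form m X (k + 1), (b - θ) x = b x - θ x := fun _ => rfl
      simp only [h1, hx]
  have hfw : pullback f w = μ • w + a' := by
    refine funext fun x => ContinuousAlternatingMap.ext fun v => ?_
    change pullback f w x v = μ * w x v + (pullback f w x v + (-μ) * w x v)
    ring
  induction n with
  | zero => rw [Function.iterate_zero, pullback_id, pow_zero, one_mul]
  | succ n ih =>
    obtain ⟨g, hg⟩ := exists_coe_eq_iterate f n
    rw [← hg] at ih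
    have hgc : ContMDiff (𝓡 m) (𝓡 m) 1 g := g.contMDiff
    have hgw := hw.isContForm_pullback hgc
    have hga' : IsContForm (pullback g a') := by
      rw [ha', pullback_add, pullback_smul, ← pullback_comp hf hgc]
      exact (hw.isContForm_pullback (hf.comp hgc)).add (hgw.smul _)
    rw [Function.iterate_succ', ← hg, pullback_comp hf hgc, hfw, pullback_add, pullback_smul,
      l2Inner_add_left (hgw.smul _) hga' hw.isContForm, l2Inner_smul_left, ih,
      l2Inner_pullback_eq_zero_of_closure g hca' hga' hcl' hw.isContForm hort]
    ring

omit [T2Space X] in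
/-- A bound on `⟪g^* w, w⟫` that is linear in the supremum of the norms of `(D_x g)^{∧k}`. -/
lemma exists_norm_l2Inner_pullback_le {w : Form m X k} (hw : IsContForm w) :
    ∃ D : ℝ, ∀ (g : X → X) (r : ℝ), 0 < r → (∀ x, wedgeNorm m k g x ≤ r) →
      ‖l2Inner (pullback g w) w‖ ≤ r * D := by
  obtain ⟨M, hM⟩ := (isCompact_range (continuous_formNormSq hw)).bddAbove
  have hM' : ∀ x, formNormSq (w x) ≤ M := fun x => hM ⟨x, rfl⟩
  refine ⟨(pullbackConst m k * M + M) * (riemannianVolume m X).real Set.univ,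
    fun g r hr hg => ?_⟩
  rw [← mul_assoc]
  refine norm_integral_le_of_norm_le_const (ae_of_all _ fun x => ?_)
  refine (norm_formInner_le _ _ (inv_pos.mpr hr)).trans ?_
  have h0 : 0 ≤ wedgeNorm m k g x := wedgeOpNorm_nonneg _ _
  have h1 := pullbackConst_nonneg m k
  have h2 := formNormSq_nonneg (w (g x))
  calc r⁻¹ * formNormSq (pullback g w x) + r⁻¹⁻¹ * formNormSq (w x)
      ≤ r⁻¹ * (pullbackConst m k * wedgeNorm m k g x ^ 2 * formNormSq (w (g x))) +
        r⁻¹⁻¹ * formNormSq (w x) := by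
        gcongr
        exact formNormSq_pullback_le g w x
    _ ≤ r⁻¹ * (pullbackConst m k * r ^ 2 * M) + r⁻¹⁻¹ * M := by
        have := hM' x
        have := hM' (g x)
        have := hg x
        gcongr
    _ = r * (pullbackConst m k * M + M) := by
        field_simp
end PullbackBounds

/-! ### Exponential growth of the norms of the exterior powers -/

section Growth
variable {m : ℕ} {X : Type*} [TopologicalSpace X]
  [ChartedSpace (EuclideanSpace ℝ (Fin m)) X] [IsManifold (𝓡 m) ∞ X]
  [RiemannianBundle (fun x : X => TangentSpace (𝓡 m) x)]
  [IsContMDiffRiemannianBundle (𝓡 m) ∞ (EuclideanSpace ℝ (Fin m))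
      (fun x : X => TangentSpace (𝓡 m) x)] [CompactSpace X] {k : ℕ}

variable (m) in
/-- The supremum over `x` of `log ‖(D_x f^n)^{∧k}‖`. It is a genuine supremum, for a diffeomorphism
`f` and `k ≤ m` on a compact nonempty manifold, by `bddAbove_log_wedgeNorm_iterate`. -/
def logSupWedgeNorm (k : ℕ) (f : X → X) (n : ℕ) : ℝ :=
  ⨆ x : X, Real.log (wedgeNorm m k f^[n] x)

lemma bddAbove_log_wedgeNorm_iterate (hkm : k ≤ m) (f : X ≃ₘ^1⟮𝓡 m, 𝓡 m⟯ X) (n : ℕ) :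
    BddAbove (Set.range fun x => Real.log (wedgeNorm m k f^[n] x)) := by
  obtain ⟨g, hg⟩ := exists_coe_eq_iterate f n
  rw [← hg]
  exact bddAbove_log_wedgeNorm hkm g

lemma wedgeNorm_iterate_le (hkm : k ≤ m) (f : X ≃ₘ^1⟮𝓡 m, 𝓡 m⟯ X) (n : ℕ) (x : X) :
    wedgeNorm m k f^[n] x ≤ Real.exp (logSupWedgeNorm m k f n) := by
  have h := le_ciSup (bddAbove_log_wedgeNorm_iterate hkm f n) x
  obtain ⟨g, hg⟩ := exists_coe_eq_iterate f n
  refine (Real.log_le_iff_le_exp ?_).mp h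
  rw [← hg]
  exact wedgeNorm_pos hkm g x

/-- Subadditivity, by the chain rule. -/
lemma subadditive_logSupWedgeNorm [Nonempty X] (hkm : k ≤ m) (f : X ≃ₘ^1⟮𝓡 m, 𝓡 m⟯ X) :
    Subadditive (logSupWedgeNorm m k f) := fun p q => by
  refine ciSup_le fun x => ?_
  have h1 := le_ciSup (bddAbove_log_wedgeNorm_iterate hkm f p) (f^[q] x)
  have h2 := le_ciSup (bddAbove_log_wedgeNorm_iterate hkm f q) x
  refine le_trans ?_ (add_le_add h1 h2)
  obtain ⟨g, hg⟩ := exists_coe_eq_iterate f p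
  obtain ⟨g', hg'⟩ := exists_coe_eq_iterate f q
  obtain ⟨g'', hg''⟩ := exists_coe_eq_iterate f (p + q)
  have h3 := wedgeNorm_comp_le k g.contMDiff g'.contMDiff x
  have h4 := wedgeNorm_pos hkm g'' x
  rw [hg'', Function.iterate_add, ← hg, ← hg'] at h4
  rw [Function.iterate_add, ← hg, ← hg',
    ← Real.log_mul (wedgeNorm_pos hkm g _).ne' (wedgeNorm_pos hkm g' x).ne']
  exact Real.log_le_log h4 h3

variable [MeasurableSpace X] [BorelSpace X] [T2Space X]

/-- The norms of `(D f^n)^{∧k}` grow at least like `exp (n Re μ)`, as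
`e^{n Re μ} ‖w‖² = |⟪(f^n)^* w, w⟫|` is bounded by a constant times their supremum. -/
lemma exists_mul_re_le (hkm : k + 1 ≤ m) (f : X ≃ₘ^1⟮𝓡 m, 𝓡 m⟯ X) {w a : Form m X (k + 1)} {μ : ℂ}
    (hw : IsHarmonic w) (hw0 : w ≠ 0) (ha : MemClosureExact a)
    (heq : ∀ᵐ x ∂(riemannianVolume m X), pullback f w x = Complex.exp μ • w x + a x) :
    ∃ c : ℝ, ∀ n : ℕ, n * μ.re ≤ logSupWedgeNorm m (k + 1) f n + c := by
  obtain ⟨D, hD⟩ := exists_norm_l2Inner_pullback_le hw.1.isContForm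
  set N := ∫ x, formNormSq (w x) ∂(riemannianVolume m X) with hN
  have hN0 : 0 < N := lt_of_le_of_ne (integral_nonneg fun x => formNormSq_nonneg _) fun h =>
    hw0 (eq_zero_of_integral_formNormSq_eq_zero hw.1.isContForm h.symm)
  have key : ∀ n : ℕ, Real.exp (n * μ.re) * N ≤ Real.exp (logSupWedgeNorm m (k + 1) f n) * D :=
    fun n => by
    have h := hD f^[n] _ (Real.exp_pos _) (wedgeNorm_iterate_le hkm f n)
    rwa [l2Inner_pullback_iterate f hw.1 (fun β hβ => hw.l2Inner_d hβ) ha.2 heq n, norm_mul,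
      norm_pow, Complex.norm_exp, ← Real.exp_nat_mul, l2Inner_self, Complex.norm_real,
      Real.norm_of_nonneg hN0.le] at h
  have hD0 : 0 < D := by
    have h := (mul_pos (Real.exp_pos _) hN0).trans_le (key 0)
    exact pos_of_mul_pos_right h (Real.exp_pos _).le
  refine ⟨Real.log (D / N), fun n => ?_⟩
  rw [← Real.exp_le_exp, Real.exp_add, Real.exp_log (by positivity), ← mul_div_assoc,
    le_div_iff₀ hN0]
  exact key n
end Growth

/-- Fekete's lemma for a sequence with a linear lower bound. -/
lemma exists_tendsto_of_subadditive {s : ℕ → ℝ} (hs : Subadditive s) {r c : ℝ}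
    (h : ∀ n : ℕ, n * r ≤ s n + c) : ∃ L, Tendsto (fun n => s n / n) atTop (𝓝 L) ∧ r ≤ L := by
  have h1 : ∀ n : ℕ, 0 < n → r - c / n ≤ s n / n := fun n hn => by
    have hn' : (0 : ℝ) < n := Nat.cast_pos.mpr hn
    rw [le_div_iff₀ hn', sub_mul, div_mul_cancel₀ _ hn'.ne']
    linarith [h n, mul_comm r (n : ℝ)]
  have hb : BddBelow (Set.range fun n => s n / n) := by
    refine ⟨-(|r| + |c|), ?_⟩
    rintro - ⟨n, rfl⟩
    rcases Nat.eq_zero_or_pos n with rfl | hn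
    · simp only [Nat.cast_zero, div_zero]
      linarith [abs_nonneg r, abs_nonneg c]
    · refine le_trans ?_ (h1 n hn)
      have h2 : c / n ≤ |c| := (div_le_div_of_nonneg_right (le_abs_self c) n.cast_nonneg).trans
        (div_le_self (abs_nonneg c) (by exact_mod_cast hn))
      linarith [neg_abs_le r]
  refine ⟨hs.lim, hs.tendsto_lim hb, ?_⟩
  have h3 : Tendsto (fun n : ℕ => r - c / n) atTop (𝓝 (r - 0)) :=
    tendsto_const_nhds.sub (tendsto_const_div_atTop_nhds_zero_nat c)
  rw [sub_zero] at h3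
  exact le_of_tendsto_of_tendsto h3 (hs.tendsto_lim hb) ((eventually_gt_atTop 0).mono h1)

end HodgeLyapunov
end

theorem theoremA {m : ℕ} {X : Type*} [TopologicalSpace X] [T2Space X] [CompactSpace X]
    [ChartedSpace (EuclideanSpace ℝ (Fin m)) X] [IsManifold (𝓡 m) ∞ X]
    [RiemannianBundle (fun x : X => TangentSpace (𝓡 m) x)]
    [IsContMDiffRiemannianBundle (𝓡 m) ∞ (EuclideanSpace ℝ (Fin m))
      (fun x : X => TangentSpace (𝓡 m) x)]
    [MeasurableSpace X] [BorelSpace X]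
    (f : X ≃ₘ^1⟮𝓡 m, 𝓡 m⟯ X) (k : ℕ) (hk : 1 ≤ k) (hkm : k ≤ m) (lam : ℂ)
    (w α : HodgeLyapunov.Form m X k) (hw : HodgeLyapunov.IsHarmonic w) (hw0 : w ≠ 0)
    (hα : HodgeLyapunov.MemClosureExact α)
    (heq : ∀ᵐ x ∂(HodgeLyapunov.riemannianVolume m X),
      HodgeLyapunov.pullback f w x = Complex.exp lam • w x + α x) :
    (∀ n : ℕ, BddAbove (Set.range fun x : X =>
      (1 / (n : ℝ)) * Real.log (HodgeLyapunov.wedgeNorm m k (f^[n]) x))) ∧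
    ∃ L : ℝ,
      Tendsto (fun n : ℕ =>
        ⨆ x : X, (1 / (n : ℝ)) * Real.log (HodgeLyapunov.wedgeNorm m k (f^[n]) x)) atTop (𝓝 L) ∧
      lam.re ≤ L := by
  have : Nonempty X := by
    by_contra h
    rw [not_nonempty_iff] at h
    exact hw0 (funext fun x => h.elim x)
  refine ⟨fun n => ?_, ?_⟩
  · obtain ⟨B, hB⟩ := HodgeLyapunov.bddAbove_log_wedgeNorm_iterate hkm f n
    refine ⟨1 / (n : ℝ) * B, ?_⟩
    rintro - ⟨x, rfl⟩
    exact mul_le_mul_of_nonneg_left (hB ⟨x, rfl⟩) (by positivity)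
  · obtain ⟨k, rfl⟩ := Nat.exists_eq_add_of_le' hk
    obtain ⟨c, hc⟩ := HodgeLyapunov.exists_mul_re_le hkm f hw hw0 hα heq
    obtain ⟨L, hL, hle⟩ := HodgeLyapunov.exists_tendsto_of_subadditive
      (HodgeLyapunov.subadditive_logSupWedgeNorm hkm f) hc
    refine ⟨L, hL.congr fun n => ?_, hle⟩
    rw [← Real.mul_iSup_of_nonneg (by positivity), one_div, inv_mul_eq_div]
    rfl
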